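/- **Setting.** Let $X\subseteq\mathbb R^m$ be closed and convex, $f:X\to\mathbb R$ convex with minimum $f(x_\star)$ attained at $x_\star\in X$, $\|\cdot\|$ the Euclidean norm, and $\partial f(x)=\{v: f(y)\ge f(x)+\langle v,y-x\rangle\ \forall y\in X\}$. Fix $x_0\in X$, $r_\epsilon>0$ and $T\ge 1$. Given $g_0,g_1,\dots\in\mathbb R^m$, consider projected SGD $$x_{t+1}=\mathrm{Proj}_X\Big(x_t-\tfrac{\bar r_t}{\sqrt{G'_t}}\,g_t\Big),\qquad 0\le t<T,\qquad \bar r_t=\max\{\max_{k\le t}\|x_k-x_0\|,\ r_\epsilon\}.$$ Put $G_t=\sum_{k\le t}\|g_k\|^2$, $d_0=\|x_0-x_\star\|$, $\hat x_T=\frac1T\sum_{t=0}^{T-1}x_t$, $\log_+ z=1+\log z$ and $\theta_{T,\delta}=\log\frac{60\log(6T)}{\delta}$. The scheme is *DoG-like* if $G'_0,\dots,G'_{T-1}$ is a positive nondecreasing sequence, $G'_t$ depends only on $x_0,g_0,\dots,g_t$, and $G'_t\ge G_t$. The choice $G'_t=G_t$ is *DoG* (with the convention that the step is zero as long as $G_t=0$).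 There is a universal constant $C>0$ such that the following hold. **(1) Stochastic case.** Let the $g_t$ be the answers of a stochastic gradient oracle $\mathcal G$ queried at $x_t$ (given $g_0,\dots,g_{t-1}$, the law of $g_t$ is that of $\mathcal G(x_t)$), where $\mathbb E[\mathcal G(x)]\in\partial f(x)$ and $\|\mathcal G(x)\|\le\ell(x)$ almost surely for all $x\in X$, with $\ell:X\to\mathbb R$ continuous. Let $\bar L_T=\max_{k\le T}\ell(x_k)$. For all $\delta\in(0,1)$ and $L>0$, every DoG-like scheme satisfies, with probability at least $1-\delta-\mathbb P(\bar L_T>L)$, $$f(\hat x_T)-f(x_\star)\le C\,\frac{\big(d_0\log_+\frac{\bar r_T}{r_\epsilon}+\bar r_T\big)\sqrt{G'_{T-1}+G_{T-1}\theta_{T,\delta}+L^2\theta_{T,\delta}^2}}{T}.$$ **(2) Noiseless case.** If $g_t\in\partial f(x_t)$ for all $t<T$, then every DoG-like scheme satisfies (deterministically) $$f(\hat x_T)-f(x_\star)\le\frac1T\sum_{t=0}^{T-1}f(x_t)-f(x_\star)\le C\,\frac{\big(d_0\log_+\frac{\bar r_T}{r_\epsilon}+\bar r_T\big)\sqrt{G'_{T-1}}}{T}.$$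 **(3) Smooth noiseless case.** Suppose that $f$ is defined, convex and differentiable on all of $\mathbb R^m$ with $S$-Lipschitz gradient, that $x_\star\in X$ minimizes $f$ over $\mathbb R^m$ (for instance $X=\mathbb R^m$), and that $g_t=\nabla f(x_t)$ for all $t<T$. Then DoG satisfies $$f(\hat x_T)-f(x_\star)\le\frac1T\sum_{t=0}^{T-1}f(x_t)-f(x_\star)\le C\,\frac{S\big(d_0\log_+\frac{\bar r_T}{r_\epsilon}+\bar r_T\big)^2}{T}.$$ -/

import Mathlib

open MeasureTheory ProbabilityTheory

noncomputable section

namespace DoG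

variable {E : Type*} [NormedAddCommGroup E] [InnerProductSpace ℝ E]

/-- The convexity assumption: `X` is closed and convex, `f` is convex on `X`, and the minimum of `f`
over `X` is attained at `xs ∈ X`. (Values of `f` outside `X` are irrelevant.) -/
structure ConvexProblem (X : Set E) (f : E → ℝ) (xs : E) : Prop where
  isClosed : IsClosed X
  convexOn : ConvexOn ℝ X f
  mem : xs ∈ X
  isMinOn : IsMinOn f X xs

/-- The subdifferential at `x` of the function `f` with domain `X`. -/
def subdiff (X : Set E) (f : E → ℝ) (x : E) : Set E :=
  {v | ∀ y ∈ X, f x + inner ℝ v (y - x) ≤ f y}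

/-- The Euclidean projection onto `X`: the point of `X` nearest to `y`. -/
def proj (X : Set E) (y : E) : E :=
  Classical.epsilon fun p => p ∈ X ∧ ∀ z ∈ X, dist y p ≤ dist y z

/-- The nearest point exists, so `proj` is what it should be. -/
theorem proj_spec [FiniteDimensional ℝ E] {X : Set E} (hX : IsClosed X) (hne : X.Nonempty)
    (y : E) : proj X y ∈ X ∧ ∀ z ∈ X, dist y (proj X y) ≤ dist y z := by
  have : ProperSpace E := FiniteDimensional.proper ℝ E
  refine Classical.epsilon_spec (p := fun p => p ∈ X ∧ ∀ z ∈ X, dist y p ≤ dist y z) ?_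
  obtain ⟨p, hp, h⟩ := hX.exists_infDist_eq_dist hne y
  exact ⟨p, hp, fun z hz => h ▸ Metric.infDist_le_dist_of_mem hz⟩

/-- `r̄_t = max (max_{k ≤ t} ‖x_k - x_0‖) rε`. -/
def rbar (rε : ℝ) (x : ℕ → E) (t : ℕ) : ℝ :=
  max ((Finset.range (t + 1)).sup' Finset.nonempty_range_add_one fun k => ‖x k - x 0‖) rε

/-- `G_t = ∑_{k ≤ t} ‖g_k‖²`. -/
def gradSq (g : ℕ → E) (t : ℕ) : ℝ :=
  ∑ k ∈ Finset.range (t + 1), ‖g k‖ ^ 2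

/-- `L̄_t = max_{k ≤ t} ℓ(x_k)`. -/
def Lbar (l : E → ℝ) (x : ℕ → E) (t : ℕ) : ℝ :=
  (Finset.range (t + 1)).sup' Finset.nonempty_range_add_one fun k => l (x k)

/-- The uniform average `x̂_T = (1/T) ∑_{t < T} x_t`. -/
def avg (x : ℕ → E) (T : ℕ) : E :=
  (T : ℝ)⁻¹ • ∑ t ∈ Finset.range T, x t

/-- `log₊ z = 1 + log z`. -/
def logp (z : ℝ) : ℝ := 1 + Real.log z

/-- `θ_{t,δ} = log (60 log(6t) / δ)`. -/
def theta (t : ℕ) (δ : ℝ) : ℝ := Real.log (60 * Real.log (6 * t) / δ)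

/-- `T` iterations of projected SGD with the step sizes `η_t = r̄_t / √G'_t`. -/
def IsRun (X : Set E) (rε : ℝ) (G' : ℕ → ℝ) (g x : ℕ → E) (T : ℕ) : Prop :=
  ∀ t < T, x (t + 1) = proj X (x t - (rbar rε x t / √(G' t)) • g t)

/-- The conditions on the sequence `G'_0, …, G'_{T-1}` in a DoG-like scheme: positive,
nondecreasing and at least `G_t`. -/
structure IsDoGLike (G' : ℕ → ℝ) (g : ℕ → E) (T : ℕ) : Prop where
  pos : ∀ t < T, 0 < G' t
  mono : ∀ s t, s ≤ t → t < T → G' s ≤ G' t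
  le : ∀ t < T, gradSq g t ≤ G' t

/-- A stochastic gradient oracle for `f`, given by the law `O x` of its answer to the query `x`:
the mean of the answer is a subgradient at `x`. -/
def IsOracle [MeasurableSpace E] (X : Set E) (f : E → ℝ) (O : Kernel E E) : Prop :=
  ∀ x ∈ X, Integrable (fun v => v) (O x) ∧ ∫ v, v ∂(O x) ∈ subdiff X f x

/-- Pointwise bounded stochastic gradients: `‖O x‖ ≤ ℓ(x)` almost surely, `ℓ` continuous. -/
def IsBoundedOracle [MeasurableSpace E] (X : Set E) (l : E → ℝ) (O : Kernel E E) : Prop :=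
  ContinuousOn l X ∧ ∀ x ∈ X, ∀ᵐ v ∂(O x), ‖v‖ ≤ l x

/-- A stochastic DoG-like run of `T` iterations from `x₀` with the oracle `O`. At each step the
oracle is queried at the current iterate: given the earlier answers `g_0, …, g_{t-1}`, the answer
`g_t` has law `O (x_t)`. The quantity `G'_t` is a (measurable) function of `g_0, …, g_t`
(and of the constant `x₀`). -/
structure IsStochasticRun [MeasurableSpace E] [StandardBorelSpace E]
    {Ω : Type*} [MeasurableSpace Ω] (μ : Measure Ω) [IsFiniteMeasure μ]
    (X : Set E) (O : Kernel E E) (x₀ : E) (rε : ℝ) (T : ℕ)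
    (G' : ℕ → Ω → ℝ) (g x : ℕ → Ω → E) : Prop where
  start : ∀ ω, x 0 ω = x₀
  step : ∀ ω, IsRun X rε (G' · ω) (g · ω) (x · ω) T
  measurable_grad : ∀ t < T, Measurable (g t)
  law_grad : ∀ t < T, ∀ᵐ ω ∂μ,
    condDistrib (g t) (fun ω' (k : Fin t) => g k ω') μ (fun k => g k ω) = O (x t ω)
  adapted : ∀ t < T, ∃ φ : (Fin (t + 1) → E) → ℝ,
    Measurable φ ∧ ∀ ω, G' t ω = φ (fun k => g k ω)
  dogLike : ∀ᵐ ω ∂μ, IsDoGLike (G' · ω) (g · ω) T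

end DoG

end

/-! Weighting the regret terms by r̄_t cancels the numerator of the step size. Nonexpansiveness of
the projection then gives r̄_t⟨g_t, x_t − x⋆⟩ ≤ ½√G'_t (‖x_t − x⋆‖² − ‖x_{t+1} − x⋆‖²) + ½ r̄_t²
‖g_t‖²/√G'_t, and Abel summation bounds every prefix W_n of the weighted regret by 3 r̄_n (d₀ +
r̄_n) √G'_{T−1} (`IsRun.sum_rbar_mul_inner_le`). A second Abel summation, with weights 1/r̄_s,
removes the weights (`IsRun.sum_inner_le`). No step is longer than r̄_t, so r̄ at most doubles and
its relative increments add up to at most 2 log(r̄_T/rε); this is the source of the logarithm.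

That regret bound holds for arbitrary vectors g_t. With subgradients it gives the noiseless case. In
the smooth case `sq_norm_gradient_le` bounds G_{T−1} by a multiple of the regret itself, and the
resulting quadratic inequality is solved.

With noise, the mean subgradient replaces g_t at the cost of a martingale sum. The directions x_t −
x⋆ are divided by d₀ + r̄_t to lie in the unit ball, and set to zero where ℓ exceeds L. The
empirical Bernstein inequality `IsSampled.measure_abs_sum_gt_le` bounds all prefixes of the
normalized sum simultaneously. Since d₀ + r̄_t is nondecreasing, `abs_sum_mul_le` restores the scale
with a factor 2. -/

namespace DoG

/-! ### Nonexpansiveness of the Euclidean projection. -/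

section Projection

variable {E : Type*} [NormedAddCommGroup E] [InnerProductSpace ℝ E] [FiniteDimensional ℝ E]

theorem inner_sub_proj_le_zero {X : Set E} (hX : IsClosed X) (hc : Convex ℝ X)
    (y : E) {z : E} (hz : z ∈ X) : inner ℝ (y - proj X y) (z - proj X y) ≤ 0 := by
  have hne : X.Nonempty := ⟨z, hz⟩
  obtain ⟨hp, hmin⟩ := proj_spec hX hne y
  have : Nonempty X := ⟨⟨z, hz⟩⟩
  refine (norm_eq_iInf_iff_real_inner_le_zero hc hp).1 (le_antisymm ?_ ?_) z hz
  · exact le_ciInf fun w => by simpa [dist_eq_norm] using hmin w w.2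
  · exact ciInf_le (f := fun w : X => ‖y - w‖) ⟨0, by rintro _ ⟨w, rfl⟩; positivity⟩ ⟨_, hp⟩

theorem norm_proj_sub_proj_le {X : Set E} (hX : IsClosed X) (hc : Convex ℝ X)
    (hne : X.Nonempty) (y z : E) : ‖proj X y - proj X z‖ ≤ ‖y - z‖ := by
  have h1 := inner_sub_proj_le_zero hX hc y (proj_spec hX hne z).1
  have h2 := inner_sub_proj_le_zero hX hc z (proj_spec hX hne y).1
  set p := proj X y
  set q := proj X z
  have h3 : ‖p - q‖ ^ 2 ≤ inner ℝ (y - z) (p - q) := by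
    rw [← real_inner_self_eq_norm_sq]
    simp only [inner_sub_left, inner_sub_right] at *
    linarith
  have h4 := h3.trans (real_inner_le_norm _ _)
  by_contra! h
  nlinarith [norm_nonneg (y - z), norm_nonneg (p - q)]

theorem proj_eq_self {X : Set E} (hX : IsClosed X) {y : E} (hy : y ∈ X) : proj X y = y := by
  have := (proj_spec hX ⟨y, hy⟩ y).2 y hy
  rw [dist_self] at this
  exact (dist_le_zero.1 this).symm

theorem continuous_proj {X : Set E} (hX : IsClosed X) (hc : Convex ℝ X) (hne : X.Nonempty) :
    Continuous (proj X) := by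
  refine (LipschitzWith.of_dist_le_mul (K := 1) fun y z => ?_).continuous
  simpa [dist_eq_norm] using norm_proj_sub_proj_le hX hc hne y z

theorem norm_proj_sub_le {X : Set E} (hX : IsClosed X) (hc : Convex ℝ X) (y : E) {z : E}
    (hz : z ∈ X) : ‖proj X y - z‖ ≤ ‖y - z‖ := by
  simpa [proj_eq_self hX hz] using norm_proj_sub_proj_le hX hc ⟨z, hz⟩ y z

end Projection

/-! ### Elementary facts on r̄ and G, and summation by parts. -/

section Basic

variable {E : Type*} [NormedAddCommGroup E] {rε : ℝ} {x : ℕ → E}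

theorem le_rbar (t : ℕ) : rε ≤ rbar rε x t := le_max_right _ _

theorem norm_sub_le_rbar {k t : ℕ} (h : k ≤ t) : ‖x k - x 0‖ ≤ rbar rε x t :=
  le_max_of_le_left
    (Finset.le_sup' (fun k => ‖x k - x 0‖) (Finset.mem_range.2 (Nat.lt_succ_of_le h)))

theorem rbar_mono : Monotone (rbar rε x) := fun s t h => by
  refine max_le_max (Finset.sup'_le _ _ fun k hk => ?_) le_rfl
  refine Finset.le_sup' (fun k => ‖x k - x 0‖) ?_
  rw [Finset.mem_range] at *
  omega

theorem rbar_zero (h : 0 < rε) : rbar rε x 0 = rε := by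
  simp [rbar, h.le]

theorem rbar_succ_le {t : ℕ} {M : ℝ} (h : rbar rε x t ≤ M) (h' : ‖x (t + 1) - x 0‖ ≤ M) :
    rbar rε x (t + 1) ≤ M := by
  refine max_le (Finset.sup'_le _ _ fun k hk => ?_) ((le_rbar t).trans h)
  rcases Nat.lt_succ_iff_lt_or_eq.1 (Finset.mem_range.1 hk) with hk | rfl
  · exact (norm_sub_le_rbar (Nat.le_of_lt_succ hk)).trans h
  · exact h'

theorem gradSq_nonneg (g : ℕ → E) (t : ℕ) : 0 ≤ gradSq g t :=
  Finset.sum_nonneg fun _ _ => sq_nonneg _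

theorem gradSq_mono (g : ℕ → E) : Monotone (gradSq g) := fun s t h =>
  Finset.sum_le_sum_of_subset_of_nonneg (Finset.range_mono (by omega)) fun _ _ _ => sq_nonneg _

theorem gradSq_succ (g : ℕ → E) (t : ℕ) : gradSq g (t + 1) = gradSq g t + ‖g (t + 1)‖ ^ 2 :=
  Finset.sum_range_succ _ _

theorem sq_norm_le_gradSq (g : ℕ → E) (t : ℕ) : ‖g t‖ ^ 2 ≤ gradSq g t :=
  Finset.single_le_sum (f := fun k => ‖g k‖ ^ 2) (fun _ _ => sq_nonneg _)
    (Finset.self_mem_range_succ t)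

/-- The quotient convention makes this valid when `gradSq g 0 = 0`. -/
theorem sum_sq_div_sqrt_gradSq_le (g : ℕ → E) (n : ℕ) :
    ∑ s ∈ Finset.range (n + 1), ‖g s‖ ^ 2 / √(gradSq g s) ≤ 2 * √(gradSq g n) := by
  induction n with
  | zero =>
    have : gradSq g 0 = ‖g 0‖ ^ 2 := by simp [gradSq]
    simp only [zero_add, Finset.sum_range_one, this, Real.div_sqrt]
    linarith [Real.sqrt_nonneg (‖g 0‖ ^ 2)]
  | succ n ih =>
    rw [Finset.sum_range_succ]
    have h0 := gradSq_nonneg g n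
    have h1 := gradSq_nonneg g (n + 1)
    rcases h1.eq_or_lt with h | h
    · have h2 : gradSq g n ≤ 0 := h ▸ gradSq_mono g n.le_succ
      simp only [← h, Real.sqrt_zero, div_zero, add_zero, mul_zero]
      rw [Real.sqrt_eq_zero_of_nonpos h2] at ih
      linarith
    · have hs := Real.sqrt_pos.2 h
      have hle : ‖g (n + 1)‖ ^ 2 / √(gradSq g (n + 1))
          ≤ 2 * √(gradSq g (n + 1)) - 2 * √(gradSq g n) := by
        rw [div_le_iff₀ hs]
        have e1 := Real.sq_sqrt h0
        have e2 := Real.sq_sqrt h1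
        have e3 := gradSq_succ g n
        nlinarith [sq_nonneg (√(gradSq g (n + 1)) - √(gradSq g n))]
      linarith

theorem norm_le_sqrt_of_gradSq_le {G' : ℕ → ℝ} {g : ℕ → E} {t : ℕ} (hle : gradSq g t ≤ G' t) : ‖g t‖ ≤ √(G' t) :=
  Real.le_sqrt_of_sq_le ((sq_norm_le_gradSq g t).trans hle)

theorem norm_sub_le_add_rbar {xs : E} {s t : ℕ} (hst : s ≤ t) :
    ‖x s - xs‖ ≤ ‖x 0 - xs‖ + rbar rε x t := by
  have := norm_sub_le_rbar (rε := rε) (x := x) hst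
  have := norm_sub_le_norm_sub_add_norm_sub (x s) (x 0) xs
  linarith

/-- Factor the difference of squares: the difference of distances is at most 2 r̄_t, their sum at
most 2(d₀ + r̄_t). The factor r̄_t must survive, since it is divided out when the weights are
removed. -/
theorem sq_norm_sub_sq_norm_le {xs : E} {s t : ℕ} (hst : s ≤ t) :
    ‖x s - xs‖ ^ 2 ≤ ‖x t - xs‖ ^ 2 + 4 * (rbar rε x t * (‖x 0 - xs‖ + rbar rε x t)) := by
  have h1 := norm_sub_le_add_rbar (xs := xs) (rε := rε) (x := x) hst
  have h2 := norm_sub_le_add_rbar (xs := xs) (rε := rε) (x := x) (le_refl t)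
  have h3 := norm_sub_le_rbar (rε := rε) (x := x) hst
  have h4 := norm_sub_le_rbar (rε := rε) (x := x) (le_refl t)
  have h5 : ‖x s - xs‖ - ‖x t - xs‖ ≤ 2 * rbar rε x t := by
    have := norm_sub_le_norm_sub_add_norm_sub (x s) (x t) xs
    have := norm_sub_le_norm_sub_add_norm_sub (x s) (x 0) (x t)
    rw [norm_sub_rev (x 0)] at this
    linarith
  have h6 : 0 ≤ ‖x s - xs‖ + ‖x t - xs‖ := by positivity
  have h7 : 0 ≤ rbar rε x t := (norm_nonneg _).trans h4
  nlinarith [mul_le_mul_of_nonneg_right h5 h6]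

/-- Abel summation with monotone weights. -/
theorem sum_mul_sub_succ_le {c e : ℕ → ℝ} {M : ℝ} {n : ℕ} (hc0 : 0 ≤ c 0)
    (hc : ∀ s < n, c s ≤ c (s + 1)) (he : ∀ s ≤ n, e s ≤ M) :
    ∑ s ∈ Finset.range (n + 1), c s * (e s - e (s + 1)) ≤ c n * (M - e (n + 1)) := by
  induction n with
  | zero =>
    simp only [zero_add, Finset.sum_range_one]
    nlinarith [he 0 le_rfl]
  | succ n ih =>
    rw [Finset.sum_range_succ]
    have := ih (fun s hs => hc s (by omega)) (fun s hs => he s (by omega))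
    nlinarith [hc n (by omega), he (n + 1) le_rfl]

/-- Partial sums weighted by a monotone sequence. -/
theorem abs_sum_mul_le {y z : ℕ → ℝ} {B : ℝ} (hy0 : ∀ t, 0 ≤ y t) (hy : Monotone y) {n : ℕ}
    (hz : ∀ k ≤ n, |∑ s ∈ Finset.range k, z s| ≤ B) :
    |∑ s ∈ Finset.range n, y s * z s| ≤ 2 * y n * B := by
  -- From k to k + 1 this difference changes by (y_k − y_{k+1}) times the prefix sum of length k +
  -- 1, so the errors telescope to at most y_k B.
  have key : ∀ k ≤ n, |∑ s ∈ Finset.range k, y s * z s - y k * ∑ s ∈ Finset.range k, z s|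
      ≤ y k * B := by
    intro k
    induction k with
    | zero =>
      intro h
      have : 0 ≤ B := by simpa using hz 0 h
      simpa using mul_nonneg (hy0 0) this
    | succ k ih =>
      intro h
      have h1 := ih (by omega)
      have h2 := hz (k + 1) h
      have h3 := hy k.le_succ
      rw [Finset.sum_range_succ] at h2 ⊢
      rw [Finset.sum_range_succ]
      rw [abs_le] at *
      constructor <;> nlinarith
  have h1 := key n le_rfl
  have h2 := hz n le_rfl
  have h3 := hy0 n
  rw [abs_le] at *
  constructor <;> nlinarith

end Basic

/-! ### Weighted and unweighted regret. -/

section Regret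

variable {E : Type*} [NormedAddCommGroup E] [InnerProductSpace ℝ E] [FiniteDimensional ℝ E]
  {X : Set E} {xs : E} {rε : ℝ} {G' : ℕ → ℝ} {g x : ℕ → E} {T : ℕ}

theorem IsRun.mem (hX : IsClosed X) (h : IsRun X rε G' g x T) (h0 : x 0 ∈ X) :
    ∀ t ≤ T, x t ∈ X := by
  intro t ht
  cases t with
  | zero => exact h0
  | succ t => rw [h t ht]; exact (proj_spec hX ⟨_, h0⟩ _).1

/-- Since ‖g_t‖ ≤ √G'_t, the step has length at most r̄_t. -/
theorem IsRun.rbar_succ_le_two_mul (hX : IsClosed X) (hc : Convex ℝ X) (hr : 0 < rε)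
    (h : IsRun X rε G' g x T) (h0 : x 0 ∈ X) {t : ℕ} (ht : t < T) (hle : gradSq g t ≤ G' t) :
    rbar rε x (t + 1) ≤ 2 * rbar rε x t := by
  have hpos : 0 < rbar rε x t := hr.trans_le (le_rbar t)
  refine rbar_succ_le (by linarith) ?_
  have h1 : ‖x (t + 1) - x t‖ ≤ rbar rε x t := by
    rw [h t ht]
    refine (norm_proj_sub_le hX hc _ (h.mem hX h0 t ht.le)).trans ?_
    rw [sub_sub_cancel_left, norm_neg, norm_smul, Real.norm_of_nonneg (by positivity),
      div_mul_eq_mul_div]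
    exact div_le_of_le_mul₀ (Real.sqrt_nonneg _) hpos.le
      (mul_le_mul_of_nonneg_left (norm_le_sqrt_of_gradSq_le hle) hpos.le)
  have h2 := norm_sub_le_rbar (rε := rε) (x := x) (le_refl t)
  have h3 := norm_sub_le_norm_sub_add_norm_sub (x (t + 1)) (x t) (x 0)
  linarith

theorem IsRun.rbar_mul_inner_le (hX : IsClosed X) (hc : Convex ℝ X) (hxs : xs ∈ X)
    (h : IsRun X rε G' g x T) {t : ℕ} (ht : t < T) (hle : gradSq g t ≤ G' t) :
    rbar rε x t * inner ℝ (g t) (x t - xs) ≤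
      (√(G' t) * (‖x t - xs‖ ^ 2 - ‖x (t + 1) - xs‖ ^ 2)
        + rbar rε x t ^ 2 * (‖g t‖ ^ 2 / √(G' t))) / 2 := by
  have hg := norm_le_sqrt_of_gradSq_le hle
  -- G'_t = 0 is allowed, so that DoG is covered before its first nonzero gradient; then g_t = 0 and
  -- both sides vanish.
  rcases (Real.sqrt_nonneg (G' t)).eq_or_lt with hs | hs
  · have : g t = 0 := by rw [← hs] at hg; exact norm_le_zero_iff.1 hg
    simp [this, ← hs]
  · have h1 := norm_proj_sub_le hX hc (x t - (rbar rε x t / √(G' t)) • g t) hxs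
    rw [← h t ht, sub_right_comm] at h1
    have h2 := pow_le_pow_left₀ (norm_nonneg _) h1 2
    rw [norm_sub_sq_real (x t - xs), inner_smul_right, norm_smul, mul_pow, Real.norm_eq_abs, sq_abs,
      real_inner_comm] at h2
    have h3 := mul_le_mul_of_nonneg_left h2 hs.le
    have e1 : √(G' t) * (‖x t - xs‖ ^ 2
          - 2 * (rbar rε x t / √(G' t) * inner ℝ (g t) (x t - xs))
          + (rbar rε x t / √(G' t)) ^ 2 * ‖g t‖ ^ 2) =
        √(G' t) * ‖x t - xs‖ ^ 2 - 2 * (rbar rε x t * inner ℝ (g t) (x t - xs))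
          + rbar rε x t ^ 2 * (‖g t‖ ^ 2 / √(G' t)) := by
      field_simp
    rw [e1] at h3
    linarith

/-- The distance terms, with nondecreasing weights √G'_s, contribute 2 r̄_n(d₀ + r̄_n)√G'_{T−1}; the
gradient terms contribute r̄_n²√G'_{T−1}. Together this is at most the constant 3. -/
theorem IsRun.sum_rbar_mul_inner_le (hX : IsClosed X) (hc : Convex ℝ X) (hxs : xs ∈ X)
    (hr : 0 < rε) (h : IsRun X rε G' g x T)
    (hmono : ∀ s t, s ≤ t → t < T → G' s ≤ G' t) (hle : ∀ t < T, gradSq g t ≤ G' t)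
    {n : ℕ} (hn : n ≤ T) :
    ∑ s ∈ Finset.range n, rbar rε x s * inner ℝ (g s) (x s - xs) ≤
      3 * (rbar rε x n * (‖x 0 - xs‖ + rbar rε x n)) * √(G' (T - 1)) := by
  have hpos : ∀ t, 0 < rbar rε x t := fun t => hr.trans_le (le_rbar t)
  cases n with
  | zero => have := hpos 0; simp only [Finset.range_zero, Finset.sum_empty]; positivity
  | succ n =>
    set r := rbar rε x (n + 1)
    have hrp : 0 < r := hpos _
    have h1 : ∑ s ∈ Finset.range (n + 1), rbar rε x s * inner ℝ (g s) (x s - xs) ≤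
        ∑ s ∈ Finset.range (n + 1), ((√(G' s) * (‖x s - xs‖ ^ 2 - ‖x (s + 1) - xs‖ ^ 2)) / 2
          + r ^ 2 * (‖g s‖ ^ 2 / √(gradSq g s)) / 2) := by
      refine Finset.sum_le_sum fun s hs => ?_
      have hsT : s < T := by have := Finset.mem_range.1 hs; omega
      have hsr : rbar rε x s ≤ r := rbar_mono (by have := Finset.mem_range.1 hs; omega)
      have a1 := h.rbar_mul_inner_le hX hc hxs hsT (hle s hsT)
      -- Replacing G' by the smaller G makes the sum of these terms comparable to an integral of
      -- 1/√G.
      have a2 : rbar rε x s ^ 2 * (‖g s‖ ^ 2 / √(G' s)) ≤ r ^ 2 * (‖g s‖ ^ 2 / √(gradSq g s)) := by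
        refine mul_le_mul (pow_le_pow_left₀ (hpos s).le hsr 2) ?_ (by positivity) (by positivity)
        rcases (gradSq_nonneg g s).eq_or_lt with h0 | h0
        · have := sq_norm_le_gradSq g s
          have : ‖g s‖ ^ 2 = 0 := le_antisymm (by linarith) (sq_nonneg _)
          simp [this]
        · exact div_le_div_of_nonneg_left (sq_nonneg _) (Real.sqrt_pos.2 h0)
            (Real.sqrt_le_sqrt (hle s hsT))
      linarith
    rw [Finset.sum_add_distrib, ← Finset.sum_div, ← Finset.sum_div, ← Finset.mul_sum] at h1
    have h2 := sum_mul_sub_succ_le (c := fun s => √(G' s)) (e := fun s => ‖x s - xs‖ ^ 2)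
      (n := n) (Real.sqrt_nonneg _)
      (fun s hs => Real.sqrt_le_sqrt (hmono _ _ s.le_succ (by omega)))
      (fun s hs => sq_norm_sub_sq_norm_le (rε := rε) (t := n + 1) (by omega))
    have h3 := mul_le_mul_of_nonneg_left (sum_sq_div_sqrt_gradSq_le g n) (sq_nonneg r)
    have h4 : √(gradSq g n) ≤ √(G' (T - 1)) :=
      Real.sqrt_le_sqrt ((hle n hn).trans (hmono _ _ (by omega) (by omega)))
    have h5 : √(G' n) ≤ √(G' (T - 1)) :=
      Real.sqrt_le_sqrt (hmono _ _ (by omega) (by omega))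
    have h6 := mul_le_mul_of_nonneg_left h4 (sq_nonneg r)
    have h7 : 0 ≤ r * (‖x 0 - xs‖ + r) := by positivity
    have h8 := mul_le_mul_of_nonneg_left h5 h7
    have h9 : 0 ≤ r * ‖x 0 - xs‖ * √(G' (T - 1)) := by positivity
    simp only [add_sub_cancel_left] at h2
    change _ ≤ √(G' n) * (4 * (r * (‖x 0 - xs‖ + r))) at h2
    nlinarith

theorem logp_nonneg_of_le {r : ℝ} (hr : 0 < rε) (h : rε ≤ r) : 1 ≤ logp (r / rε) := by
  have := Real.log_nonneg ((one_le_div hr).2 h)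
  unfold logp
  linarith

/-- The regret bound for DoG-like schemes with arbitrary vectors `g t`. -/
theorem IsRun.sum_inner_le (hX : IsClosed X) (hc : Convex ℝ X) (hxs : xs ∈ X)
    (hr : 0 < rε) (h : IsRun X rε G' g x T) (h0 : x 0 ∈ X)
    (hmono : ∀ s t, s ≤ t → t < T → G' s ≤ G' t) (hle : ∀ t < T, gradSq g t ≤ G' t) :
    ∑ s ∈ Finset.range T, inner ℝ (g s) (x s - xs) ≤
      9 * ((‖x 0 - xs‖ * logp (rbar rε x T / rε) + rbar rε x T) * √(G' (T - 1))) := by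
  have hpos : ∀ t, 0 < rbar rε x t := fun t => hr.trans_le (le_rbar t)
  set d := ‖x 0 - xs‖
  set Q := √(G' (T - 1))
  have hQ : 0 ≤ Q := Real.sqrt_nonneg _
  have hd : 0 ≤ d := norm_nonneg _
  let W : ℕ → ℝ := fun n => ∑ s ∈ Finset.range n, rbar rε x s * inner ℝ (g s) (x s - xs)
  have hW : ∀ n ≤ T, W n ≤ 3 * (rbar rε x n * (d + rbar rε x n)) * Q := fun n hn =>
    h.sum_rbar_mul_inner_le hX hc hxs hr hmono hle hn
  -- Summation by parts: the left side grows by W_{n+1}(1/r̄_n − 1/r̄_{n+1}), whose second factor is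
  -- nonnegative, so only an upper bound on W is needed.
  have key : ∀ n ≤ T, ∑ s ∈ Finset.range n, inner ℝ (g s) (x s - xs) - W n / rbar rε x n ≤
      3 * Q * (2 * d * Real.log (rbar rε x n / rε) + 2 * (rbar rε x n - rε)) := by
    intro n
    induction n with
    | zero => intro _; simp [W, rbar_zero hr, hr.ne']
    | succ n ih =>
      intro hn
      have h1 := ih (by omega)
      have h2 := hW (n + 1) hn
      have h3 := h.rbar_succ_le_two_mul hX hc hr h0 hn (hle n hn)
      have h4 : rbar rε x n ≤ rbar rε x (n + 1) := rbar_mono n.le_succ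
      have hWs : W (n + 1) = W n + rbar rε x n * inner ℝ (g n) (x n - xs) :=
        Finset.sum_range_succ _ _
      rw [Finset.sum_range_succ]
      have p := hpos n
      have p' := hpos (n + 1)
      set a := rbar rε x n
      set b := rbar rε x (n + 1)
      have e1 : inner ℝ (g n) (x n - xs) = (W (n + 1) - W n) / a := by
        rw [hWs]; field_simp; ring
      have e2 : Real.log (b / rε) = Real.log (a / rε) + Real.log (b / a) := by
        rw [← Real.log_mul (by positivity) (by positivity)]
        congr 1
        field_simp
      -- Doubling at most is essential here: a relative increment can exceed any multiple of its
      -- logarithm unless b/a is bounded.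
      have h5 : (b - a) / a ≤ 2 * Real.log (b / a) := by
        have h6 := Real.one_sub_inv_le_log_of_pos (x := b / a) (by positivity)
        rw [inv_div] at h6
        have h7 : (b - a) / a ≤ 2 * (1 - a / b) := by
          rw [div_le_iff₀ p, ← sub_nonneg]
          have : 2 * (1 - a / b) * a - (b - a) = (b - a) * (2 * a - b) / b := by
            field_simp
          rw [this]
          exact div_nonneg (mul_nonneg (by linarith) (by linarith)) p'.le
        linarith
      have h8 : W (n + 1) * (1 / a - 1 / b) ≤
          3 * Q * (d * ((b - a) / a) + 2 * (b - a)) := by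
        have h9 : 0 ≤ 1 / a - 1 / b := sub_nonneg.2 (one_div_le_one_div_of_le p h4)
        refine (mul_le_mul_of_nonneg_right h2 h9).trans ?_
        have e3 : 3 * (b * (d + b)) * Q * (1 / a - 1 / b) =
            3 * Q * (d * ((b - a) / a) + (b / a) * (b - a)) := by
          field_simp
        rw [e3]
        have h10 : b / a ≤ 2 := by rw [div_le_iff₀ p]; linarith
        have h11 := mul_le_mul_of_nonneg_right h10 (sub_nonneg.2 h4)
        gcongr
      have e4 : (W (n + 1) - W n) / a = W (n + 1) * (1 / a - 1 / b) + W (n + 1) / b - W n / a := by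
        ring
      rw [e1, e2, e4]
      have h12 := mul_le_mul_of_nonneg_left (mul_le_mul_of_nonneg_left h5 hd)
        (by positivity : 0 ≤ 3 * Q)
      linarith
  have h1 := key T le_rfl
  have h2 := hW T le_rfl
  have p := hpos T
  have hl := logp_nonneg_of_le hr (le_rbar (x := x) T)
  unfold logp at *
  set r := rbar rε x T
  set l := Real.log (r / rε)
  have h3 : W T / r ≤ 3 * (d + r) * Q := by
    rw [div_le_iff₀ p]; linarith
  have h4 : 0 ≤ l := by linarith
  have h5 : 0 ≤ Q * (d * l) := by positivity
  have h6 : 0 ≤ Q * d := by positivity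
  have h7 : 0 ≤ Q * rε := by positivity
  linarith

end Regret

/-! ### Jensen's inequality and first-order properties of convex functions. -/

section Average

variable {E : Type*} [NormedAddCommGroup E] [InnerProductSpace ℝ E]

theorem ConvexOn.map_avg_le {X : Set E} {f : E → ℝ} (hf : ConvexOn ℝ X f) {x : ℕ → E} {T : ℕ}
    (hT : 1 ≤ T) (hx : ∀ t < T, x t ∈ X) :
    f (avg x T) ≤ (1 / T : ℝ) * ∑ t ∈ Finset.range T, f (x t) := by
  have hT' : (T : ℝ) ≠ 0 := by positivity
  have := hf.map_sum_le (t := Finset.range T) (w := fun _ => (T : ℝ)⁻¹) (p := x)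
    (fun _ _ => by positivity) (by simp [hT']) (fun t ht => hx t (Finset.mem_range.1 ht))
  simpa [avg, Finset.smul_sum, Finset.mul_sum] using this

theorem mean_sub_eq {T : ℕ} (hT : 1 ≤ T) (a : ℕ → ℝ) (b : ℝ) :
    (1 / T : ℝ) * ∑ t ∈ Finset.range T, a t - b = (∑ t ∈ Finset.range T, (a t - b)) / T := by
  have hT' : (T : ℝ) ≠ 0 := by positivity
  rw [Finset.sum_sub_distrib]
  simp
  field_simp

theorem ConvexOn.add_inner_gradient_le [CompleteSpace E] {f : E → ℝ}
    (hf : ConvexOn ℝ Set.univ f) (hd : Differentiable ℝ f) (x y : E) :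
    f x + inner ℝ (gradient f x) (y - x) ≤ f y := by
  let A : ℝ →ᵃ[ℝ] E := AffineMap.lineMap x y
  have h1 : ConvexOn ℝ Set.univ (f ∘ A) := by simpa using hf.comp_affineMap A
  have h2 : HasDerivAt (f ∘ A) (inner ℝ (gradient f x) (y - x)) 0 := by
    have hA : HasDerivAt A (y - x) 0 := by simpa [A] using AffineMap.hasDerivAt_lineMap
    have hg : HasFDerivAt f (InnerProductSpace.toDual ℝ E (gradient f x)) (A 0) := by
      simpa [A] using (hd x).hasGradientAt.hasFDerivAt
    simpa using hg.comp_hasDerivAt (0 : ℝ) hA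
  have h3 := h1.le_slope_of_hasDerivAt (Set.mem_univ 0) (Set.mem_univ 1) one_pos h2
  simp only [slope_def_field, Function.comp_apply, AffineMap.lineMap_apply_zero,
    AffineMap.lineMap_apply_one, sub_zero, div_one, A] at h3
  linarith

/-- Take y = x − ∇f(x)/(2S). The gradient changes by at most ‖∇f(x)‖/2 between x and y, so the
tangent inequality at y already shows f(x) − f(y) ≥ ‖∇f(x)‖²/(4S). This avoids integrating the
gradient and costs a factor 2 against the sharp constant. -/
theorem sq_norm_gradient_le [CompleteSpace E] {f : E → ℝ} {S : NNReal} {xs : E}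
    (hf : ConvexOn ℝ Set.univ f) (hd : Differentiable ℝ f)
    (hS : LipschitzWith S (gradient f)) (hmin : ∀ y, f xs ≤ f y) (x : E) :
    ‖gradient f x‖ ^ 2 ≤ 4 * S * (f x - f xs) := by
  rcases eq_or_ne S 0 with rfl | h0
  · have h1 : gradient f x = gradient f xs := by
      have := hS.dist_le_mul x xs
      simpa using this
    have h2 : gradient f xs = 0 := by
      have : IsLocalMin f xs := Filter.Eventually.of_forall hmin
      simp [gradient, this.fderiv_eq_zero]
    simp [h1, h2]
  · have hp : (0 : ℝ) < S := by positivity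
    set v := gradient f x
    set y := x - (1 / (2 * S) : ℝ) • v
    have h1 := ConvexOn.add_inner_gradient_le hf hd y x
    have e : x - y = (1 / (2 * S) : ℝ) • v := by simp [y]
    have h2 := hS.dist_le_mul x y
    rw [dist_eq_norm, dist_eq_norm, e, norm_smul, Real.norm_of_nonneg (by positivity)] at h2
    have h3 : inner ℝ v v - inner ℝ (gradient f y) v ≤ ‖v‖ ^ 2 / 2 := by
      rw [← inner_sub_left]
      refine (real_inner_le_norm _ _).trans ((mul_le_mul_of_nonneg_right h2 (norm_nonneg _)).trans
        (le_of_eq ?_))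
      field_simp
    rw [real_inner_self_eq_norm_sq] at h3
    rw [e, inner_smul_right] at h1
    have h4 : ‖v‖ ^ 2 / 2 ≤ 2 * S * (f x - f y) := by
      have h5 := mul_le_mul_of_nonneg_left h1 (by positivity : (0 : ℝ) ≤ 2 * S)
      have e5 : 2 * (S : ℝ) * (f y + 1 / (2 * S) * inner ℝ (gradient f y) v) =
          2 * S * f y + inner ℝ (gradient f y) v := by field_simp
      linarith
    nlinarith [hmin y]

end Average

end DoG

namespace DoG

/-! ### Exponential moments, dyadic scales and the size of θ. -/

section Analysis

theorem exp_sub_sq_le {y : ℝ} (h : |y| ≤ 1 / 2) : Real.exp (y - y ^ 2) ≤ 1 + y := by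
  obtain ⟨h1, h2⟩ := abs_le.1 h
  rcases le_total 0 y with hy | hy
  · have h3 : |y - y ^ 2| ≤ 1 := abs_le.2 ⟨by nlinarith, by nlinarith⟩
    have h4 := (abs_le.1 (Real.abs_exp_sub_one_sub_id_le h3)).2
    nlinarith [mul_nonneg hy hy, mul_nonneg (mul_nonneg hy hy) hy]
  · have h3 : 0 ≤ y ^ 2 - y := by nlinarith
    have h4 := Real.quadratic_le_exp_of_nonneg h3
    rw [show y - y ^ 2 = -(y ^ 2 - y) by ring, Real.exp_neg]
    refine inv_le_of_inv_le₀ (by linarith) (le_trans ?_ h4)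
    rw [inv_le_iff_one_le_mul₀ (by linarith)]
    have h5 : 0 ≤ 1 + y - y ^ 2 + y ^ 3 := by nlinarith [mul_nonneg (sq_nonneg y) (neg_nonneg.2 hy)]
    nlinarith [mul_nonneg (sq_nonneg y) h5]

/-- Integrating exp(Y − Y²) ≤ 1 + Y leaves 1 + m ≤ exp m. The compensator is the observed Y², not a
variance, and this is what makes the later bound empirical. -/
theorem lintegral_exp_sub_sq_le {V : Type*} {_ : MeasurableSpace V} {ν : Measure V}
    [IsProbabilityMeasure ν] {Y : V → ℝ} (hY : Integrable Y ν) (hb : ∀ᵐ v ∂ν, |Y v| ≤ 1 / 2)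
    (a : ℝ) :
    ∫⁻ v, ENNReal.ofReal (Real.exp (a + (Y v - ∫ v, Y v ∂ν - Y v ^ 2))) ∂ν ≤
      ENNReal.ofReal (Real.exp a) := by
  set m := ∫ v, Y v ∂ν
  have h1 : ∀ᵐ v ∂ν, Real.exp (a + (Y v - m - Y v ^ 2)) ≤ Real.exp (a - m) * (1 + Y v) := by
    filter_upwards [hb] with v hv
    rw [show a + (Y v - m - Y v ^ 2) = (a - m) + (Y v - Y v ^ 2) by ring, Real.exp_add]
    exact mul_le_mul_of_nonneg_left (exp_sub_sq_le hv) (Real.exp_pos _).le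
  calc _ ≤ ∫⁻ v, ENNReal.ofReal (Real.exp (a - m) * (1 + Y v)) ∂ν :=
        lintegral_mono_ae (h1.mono fun v hv => ENNReal.ofReal_le_ofReal hv)
    _ = ENNReal.ofReal (∫ v, Real.exp (a - m) * (1 + Y v) ∂ν) := by
        refine (ofReal_integral_eq_lintegral_ofReal
          (((integrable_const _).add hY).const_mul _) ?_).symm
        exact h1.mono fun v hv => (Real.exp_pos _).le.trans hv
    _ ≤ ENNReal.ofReal (Real.exp a) := by
        refine ENNReal.ofReal_le_ofReal ?_
        rw [integral_const_mul, integral_add (integrable_const _) hY, integral_const]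
        simp only [probReal_univ, smul_eq_mul, one_mul]
        calc Real.exp (a - m) * (1 + m) ≤ Real.exp (a - m) * Real.exp m := by
              gcongr; linarith [Real.add_one_le_exp m]
          _ = Real.exp a := by rw [← Real.exp_add]; simp

/-- Among the scales `2 L 2 ^ j` there is one that balances `V / a` and `θ a`. -/
theorem exists_scale {L θ V : ℝ} {T : ℕ} (hL : 0 < L) (hθ : 1 ≤ θ) (hV : 0 ≤ V)
    (hVT : V ≤ L ^ 2 * T) :
    ∃ j < Nat.log 2 T + 1,
      V / (2 * L * 2 ^ j) + θ * (2 * L * 2 ^ j) ≤ 4 * (√(θ * V) + L * θ) := by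
  have hθ0 : 0 < θ := by linarith
  have hs : √(θ * V) ^ 2 = θ * V := Real.sq_sqrt (by positivity)
  have hs0 := Real.sqrt_nonneg (θ * V)
  set s := √(θ * V)
  have bound : ∀ {a : ℝ}, 0 < a → V ≤ 4 * (a ^ 2 * θ) → V / a ≤ 2 * s := fun {a} ha h => by
    rw [div_le_iff₀ ha]
    refine abs_le_of_sq_le_sq' ?_ (by positivity) |>.2
    nlinarith [mul_le_mul_of_nonneg_left h hV]
  rcases lt_or_ge (V / (4 * L ^ 2 * θ)) 1 with h | h
  · refine ⟨0, Nat.succ_pos _, ?_⟩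
    rw [div_lt_one (by positivity)] at h
    have := bound (a := 2 * L) (by positivity) (by nlinarith [mul_pos (pow_pos hL 2) hθ0])
    simp only [pow_zero, mul_one]
    nlinarith [mul_pos hL hθ0]
  -- With a = 2L·2^k this says θa² ≤ V < 4θa², so both terms are of order √(θV). The bound V ≤ L²T
  -- keeps k within log₂ T.
  · obtain ⟨k, hk1, hk2⟩ := exists_nat_pow_near h (by norm_num : (1 : ℝ) < 4)
    rw [le_div_iff₀ (by positivity)] at hk1
    rw [div_lt_iff₀ (by positivity)] at hk2
    have e4 : (4 : ℝ) ^ k = (2 ^ k) ^ 2 := by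
      rw [← pow_mul, mul_comm k 2, pow_mul]; norm_num
    have hb : (1 : ℝ) ≤ 2 ^ k := one_le_pow₀ (by norm_num)
    refine ⟨k, ?_, ?_⟩
    · have h1 : (2 : ℝ) ^ k ≤ T := by
        have h2 : (4 : ℝ) ^ k * (4 * L ^ 2 * θ) ≤ L ^ 2 * T := hk1.trans hVT
        have h3 : L ^ 2 * 2 ^ k ≤ 4 ^ k * (4 * L ^ 2 * θ) := by
          rw [e4]
          have : (2 : ℝ) ^ k * 1 ≤ (2 ^ k) ^ 2 * (4 * θ) := by
            refine mul_le_mul (by nlinarith) (by linarith) zero_le_one (by positivity)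
          nlinarith [mul_le_mul_of_nonneg_left this (sq_nonneg L)]
        exact le_of_mul_le_mul_left (h3.trans h2) (by positivity)
      have h1' : 2 ^ k ≤ T := by exact_mod_cast h1
      exact Nat.lt_succ_of_le (Nat.le_log_of_pow_le (by norm_num) h1')
    · rw [pow_succ, e4] at hk2
      rw [e4] at hk1
      set a := 2 * L * 2 ^ k with ha
      have ha0 : 0 < a := by positivity
      have h1 := bound ha0 (by rw [ha]; nlinarith)
      have h2 : θ * a ≤ s := by
        refine abs_le_of_sq_le_sq' ?_ hs0 |>.2
        rw [hs, ha]
        nlinarith [mul_le_mul_of_nonneg_left hk1 hθ0.le]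
      nlinarith [mul_pos hL hθ0]

/-- The left side counts the events in the union bound: two signs for each dyadic scale. -/
theorem two_mul_natLog_le {T : ℕ} (hT : 1 ≤ T) :
    (2 * (Nat.log 2 T + 1 : ℕ) : ℝ) ≤ 60 * Real.log (6 * T) := by
  have h1 : ((2 ^ Nat.log 2 T : ℕ) : ℝ) ≤ T := by
    exact_mod_cast Nat.pow_log_le_self 2 (by omega)
  have h2 := Real.log_le_log (by positivity) h1
  push_cast at h2 ⊢
  rw [Real.log_pow] at h2
  have h3 := Real.log_two_gt_d9
  have hT' : (1 : ℝ) ≤ T := by exact_mod_cast hT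
  rw [Real.log_mul (by norm_num) (by positivity)]
  have h4 : Real.log 2 ≤ Real.log 6 := Real.log_le_log (by norm_num) (by norm_num)
  have h5 : (0 : ℝ) ≤ Nat.log 2 T := by positivity
  nlinarith

theorem one_le_theta {T : ℕ} {δ : ℝ} (hT : 1 ≤ T) (hδ : 0 < δ) (hδ1 : δ < 1) :
    1 ≤ theta T δ := by
  have hT' : (1 : ℝ) ≤ T := by exact_mod_cast hT
  have h1 : Real.log 2 ≤ Real.log (6 * T) := Real.log_le_log (by norm_num) (by linarith)
  have h2 := Real.log_two_gt_d9
  have h3 : 0 < Real.log (6 * T) := by linarith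
  rw [theta, Real.le_log_iff_exp_le (div_pos (by linarith) hδ), le_div_iff₀ hδ]
  nlinarith [Real.exp_one_lt_d9, Real.exp_pos 1]

end Analysis

/-! ### Martingale concentration for adaptively queried oracles. -/

section Sampling

variable {E : Type*} [MeasurableSpace E] {Ω : Type*}

/-- The history `(g_0, …, g_{t-1})`. -/
def hist (g : ℕ → Ω → E) (t : ℕ) (ω : Ω) (k : Fin t) : E := g k ω

/-- The `σ`-algebra generated by the history. -/
abbrev histSigma (g : ℕ → Ω → E) (t : ℕ) : MeasurableSpace Ω :=
  MeasurableSpace.comap (hist g t) MeasurableSpace.pi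

theorem measurable_hist (g : ℕ → Ω → E) (t : ℕ) : Measurable[histSigma g t] (hist g t) :=
  comap_measurable _

theorem measurable_histSigma_of_lt (g : ℕ → Ω → E) {s t : ℕ} (h : s < t) :
    Measurable[histSigma g t] (g s) :=
  (measurable_pi_apply (⟨s, h⟩ : Fin t)).comp (measurable_hist g t)

theorem histSigma_mono (g : ℕ → Ω → E) : Monotone (histSigma g) := fun s t h => by
  refine Measurable.comap_le ?_
  let _ := histSigma g t
  exact measurable_pi_lambda _ fun k => measurable_histSigma_of_lt g (k.2.trans_le h)

theorem histSigma_le {m : MeasurableSpace Ω} {g : ℕ → Ω → E} {t : ℕ}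
    (h : ∀ s < t, Measurable (g s)) : histSigma g t ≤ m :=
  Measurable.comap_le (measurable_pi_lambda _ fun k => h k k.2)

variable [NormedAddCommGroup E]

/-- Given the history, `g_t` has law `O (x_t)`, where `x_t` is determined by the history. -/
structure IsSampled [StandardBorelSpace E] [MeasurableSpace Ω]
    (μ : Measure Ω) [IsFiniteMeasure μ] (O : Kernel E E) (g x : ℕ → Ω → E) (T : ℕ) : Prop where
  measurable_grad : ∀ t < T, Measurable (g t)
  measurable_query : ∀ t < T, Measurable[histSigma g t] (x t)
  integrable : ∀ t < T, ∀ ω, Integrable (fun v => v) (O (x t ω))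
  law : ∀ t < T, ∀ᵐ ω ∂μ, condDistrib (g t) (hist g t) μ (hist g t ω) = O (x t ω)

variable [StandardBorelSpace E] [mΩ : MeasurableSpace Ω] {μ : Measure Ω} [IsProbabilityMeasure μ]
  {O : Kernel E E} {g x : ℕ → Ω → E} {T : ℕ}

/-- The joint law of the history and g_t disintegrates along the conditional distribution, and z
factors through the history. -/
theorem IsSampled.lintegral_eq (h : IsSampled μ O g x T) {t : ℕ} (ht : t < T)
    {Z : Type*} [MeasurableSpace Z] [StandardBorelSpace Z] [Nonempty Z] {z : Ω → Z}
    (hz : Measurable[histSigma g t] z) {K : Z × E → ENNReal} (hK : Measurable K) :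
    ∫⁻ ω, K (z ω, g t ω) ∂μ = ∫⁻ ω, ∫⁻ v, K (z ω, v) ∂(O (x t ω)) ∂μ := by
  obtain ⟨φ, hφ, rfl⟩ := hz.exists_eq_measurable_comp
  have hh : Measurable (hist g t) := measurable_pi_lambda _ fun k => h.measurable_grad k (k.2.trans ht)
  have hg := h.measurable_grad t ht
  let K' : (Fin t → E) × E → ENNReal := fun p => K (φ p.1, p.2)
  have hK' : Measurable K' := hK.comp (by fun_prop)
  have h1 : ∫⁻ p, K' p ∂(μ.map fun ω => (hist g t ω, g t ω)) =
      ∫⁻ ω, K' (hist g t ω, g t ω) ∂μ := lintegral_map hK' (hh.prodMk hg)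
  rw [← compProd_map_condDistrib hg.aemeasurable, Measure.lintegral_compProd hK',
    lintegral_map (hK'.lintegral_kernel_prod_right') hh] at h1
  change ∫⁻ ω, K' (hist g t ω, g t ω) ∂μ = _
  rw [← h1]
  refine lintegral_congr_ae ?_
  filter_upwards [h.law t ht] with ω hω
  rw [hω]
  rfl

theorem IsSampled.ae_mem (h : IsSampled μ O g x T) {t : ℕ} (ht : t < T)
    {Z : Type*} [MeasurableSpace Z] [StandardBorelSpace Z] [Nonempty Z] {z : Ω → Z}
    (hz : Measurable[histSigma g t] z) {S : Set (Z × E)} (hS : MeasurableSet S)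
    (hae : ∀ ω, ∀ᵐ v ∂(O (x t ω)), (z ω, v) ∈ S) : ∀ᵐ ω ∂μ, (z ω, g t ω) ∈ S := by
  have hz' : Measurable z :=
    hz.mono (histSigma_le fun s hs => h.measurable_grad s (hs.trans ht)) le_rfl
  have hK : Measurable (Sᶜ.indicator (1 : Z × E → ENNReal)) := measurable_one.indicator hS.compl
  have h1 := h.lintegral_eq ht hz hK
  have h2 : ∀ ω, ∫⁻ v, Sᶜ.indicator (1 : Z × E → ENNReal) (z ω, v) ∂(O (x t ω)) = 0 := fun ω => by
    refine (lintegral_eq_zero_iff (f := fun v => Sᶜ.indicator (1 : Z × E → ENNReal) (z ω, v))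
      (hK.comp (by fun_prop))).2 ?_
    filter_upwards [hae ω] with v hv
    simp [hv]
  simp only [h2, lintegral_zero] at h1
  have h3 := (lintegral_eq_zero_iff
    (f := fun ω => Sᶜ.indicator (1 : Z × E → ENNReal) (z ω, g t ω))
    (hK.comp (hz'.prodMk (h.measurable_grad t ht)))).1 h1
  filter_upwards [h3] with ω hω
  by_contra hn
  simp [Set.indicator, hn] at hω

variable [InnerProductSpace ℝ E]

/-- The logarithmic increment of the exponential supermartingale with weights `w`. -/
noncomputable def logIncr (O : Kernel E E) (g x w : ℕ → Ω → E) (s : ℕ) (ω : Ω) : ℝ :=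
  inner ℝ (g s ω) (w s ω) - inner ℝ (∫ v, v ∂(O (x s ω))) (w s ω) - inner ℝ (g s ω) (w s ω) ^ 2

variable [BorelSpace E] [SecondCountableTopology E]

theorem measurable_mean {E : Type*} [NormedAddCommGroup E] [InnerProductSpace ℝ E]
    [MeasurableSpace E] [BorelSpace E] [SecondCountableTopology E] (O : Kernel E E)
    [IsMarkovKernel O] :
    Measurable fun y => ∫ v, v ∂(O y) :=
  (stronglyMeasurable_id.integral_kernel (κ := O)).measurable

variable [IsMarkovKernel O] {w : ℕ → Ω → E}

theorem IsSampled.measurable_logIncr (h : IsSampled μ O g x T)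
    (hw : ∀ s < T, Measurable[histSigma g s] (w s)) {s t : ℕ} (hst : s < t) (ht : t ≤ T) :
    Measurable[histSigma g t] (logIncr O g x w s) := by
  have h1 := measurable_histSigma_of_lt g hst
  have hs : s < T := hst.trans_le ht
  have h2 := (hw s hs).mono (histSigma_mono g hst.le) le_rfl
  have h3 := (measurable_mean O).comp
    ((h.measurable_query s hs).mono (histSigma_mono g hst.le) le_rfl)
  exact ((h1.inner h2).sub (h3.inner h2)).sub ((h1.inner h2).pow_const 2)

theorem IsSampled.measurable_sum_logIncr (h : IsSampled μ O g x T)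
    (hw : ∀ s < T, Measurable[histSigma g s] (w s)) {n t : ℕ} (hn : n ≤ t) (ht : t ≤ T) :
    Measurable[histSigma g t] fun ω => ∑ s ∈ Finset.range n, logIncr O g x w s ω :=
  Finset.measurable_fun_sum _ fun _ hs =>
    h.measurable_logIncr hw ((Finset.mem_range.1 hs).trans_le hn) ht

/-- Supermartingale property: given the history, integrating out the last answer can only decrease
the exponential. -/
theorem IsSampled.lintegral_exp_le_one [CompleteSpace E] (h : IsSampled μ O g x T)
    (hw : ∀ s < T, Measurable[histSigma g s] (w s))
    (hb : ∀ s < T, ∀ ω, ∀ᵐ v ∂(O (x s ω)), |inner ℝ v (w s ω)| ≤ 1 / 2) {n : ℕ} (hn : n ≤ T) :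
    ∫⁻ ω, ENNReal.ofReal (Real.exp (∑ s ∈ Finset.range n, logIncr O g x w s ω)) ∂μ ≤ 1 := by
  induction n with
  | zero => simp
  | succ n ih =>
    refine le_trans ?_ (ih (by omega))
    let z : Ω → ℝ × E × E := fun ω =>
      (∑ s ∈ Finset.range n, logIncr O g x w s ω, ∫ v, v ∂(O (x n ω)), w n ω)
    have hz : Measurable[histSigma g n] z :=
      (h.measurable_sum_logIncr hw le_rfl (by omega)).prodMk
        (((measurable_mean O).comp (h.measurable_query n hn)).prodMk (hw n hn))
    let K : (ℝ × E × E) × E → ENNReal := fun p => ENNReal.ofReal (Real.exp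
      (p.1.1 + (inner ℝ p.2 p.1.2.2 - inner ℝ p.1.2.1 p.1.2.2 - inner ℝ p.2 p.1.2.2 ^ 2)))
    have hK : Measurable K := by unfold K; fun_prop
    have h1 := h.lintegral_eq hn hz hK
    simp only [Finset.sum_range_succ]
    refine h1.le.trans (lintegral_mono fun ω => ?_)
    have hi := h.integrable n hn ω
    have := lintegral_exp_sub_sq_le (hi.inner_const (𝕜 := ℝ) (w n ω)) (hb n hn ω)
      (∑ s ∈ Finset.range n, logIncr O g x w s ω)
    have hm : ∫ v, inner ℝ v (w n ω) ∂(O (x n ω)) =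
        inner ℝ (∫ v, v ∂(O (x n ω))) (w n ω) := by
      rw [real_inner_comm, ← integral_inner hi]
      exact integral_congr_ae (.of_forall fun v => real_inner_comm _ _)
    rw [hm] at this
    exact this

/-- The sum stopped at the first crossing of c keeps its crossing value up to T. -/
theorem sum_ite_prefix_ge {a : ℕ → ℝ} {c : ℝ} {T n : ℕ} (hn : n ≤ T)
    (h : c ≤ ∑ s ∈ Finset.range n, a s) :
    c ≤ ∑ s ∈ Finset.range T,
      if ∀ k ≤ s, ∑ j ∈ Finset.range k, a j < c then a s else 0 := by
  classical
  let P : ℕ → Prop := fun n => c ≤ ∑ s ∈ Finset.range n, a s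
  have hex : ∃ n, P n := ⟨n, h⟩
  have hle : Nat.find hex ≤ T := (Nat.find_min' hex h).trans hn
  refine (Nat.find_spec hex).trans (le_of_eq ?_)
  rw [← Finset.sum_subset (Finset.range_mono hle)]
  · refine Finset.sum_congr rfl fun s hs => ?_
    rw [if_pos fun k hk => not_le.1 (Nat.find_min hex (hk.trans_lt (Finset.mem_range.1 hs)))]
  · intro s _ hs
    rw [if_neg]
    intro hall
    exact absurd (Nat.find_spec hex) (not_le.2 (hall _ (by simpa using hs)))

/-- Ville's inequality for the exponential supermartingale. -/
theorem IsSampled.measure_exists_le [CompleteSpace E] (h : IsSampled μ O g x T)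
    (hw : ∀ s < T, Measurable[histSigma g s] (w s))
    (hb : ∀ s < T, ∀ ω, ∀ᵐ v ∂(O (x s ω)), |inner ℝ v (w s ω)| ≤ 1 / 2) (c : ℝ) :
    μ.real {ω | ∃ n ≤ T, c ≤ ∑ s ∈ Finset.range n, logIncr O g x w s ω} ≤ Real.exp (-c) := by
  classical
  let A : ℕ → Set Ω := fun s => {ω | ∀ k ≤ s, ∑ j ∈ Finset.range k, logIncr O g x w j ω < c}
  have hA : ∀ s < T, MeasurableSet[histSigma g s] (A s) := fun s hs => by
    have : A s = ⋂ k, ⋂ (_ : k ≤ s),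
        {ω | ∑ j ∈ Finset.range k, logIncr O g x w j ω < c} := by ext; simp [A]
    rw [this]
    refine MeasurableSet.iInter fun k => MeasurableSet.iInter fun hk => ?_
    exact (h.measurable_sum_logIncr hw hk hs.le) measurableSet_Iio
  -- Stopping is done by zeroing a predictable weight: a zero weight has zero increment, so the
  -- moment bound covers the stopped process and Markov's inequality at time T suffices.
  let w' : ℕ → Ω → E := fun s ω => if ω ∈ A s then w s ω else 0
  have hw' : ∀ s < T, Measurable[histSigma g s] (w' s) := fun s hs =>
    Measurable.ite (hA s hs) (hw s hs) measurable_const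
  have hb' : ∀ s < T, ∀ ω, ∀ᵐ v ∂(O (x s ω)), |inner ℝ v (w' s ω)| ≤ 1 / 2 := fun s hs ω => by
    simp only [w']
    split_ifs
    · exact hb s hs ω
    · simp
  have hincr : ∀ s ω, logIncr O g x w' s ω = if ω ∈ A s then logIncr O g x w s ω else 0 :=
    fun s ω => by
      by_cases hs : ω ∈ A s <;> simp [logIncr, w', hs]
  have h1 := h.lintegral_exp_le_one hw' hb' le_rfl
  set F : Ω → ENNReal := fun ω =>
    ENNReal.ofReal (Real.exp (∑ s ∈ Finset.range T, logIncr O g x w' s ω))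
  have hF : Measurable F := by
    have := (h.measurable_sum_logIncr hw' (le_refl T) le_rfl).mono
      (histSigma_le h.measurable_grad) le_rfl
    exact (Real.measurable_exp.comp this).ennreal_ofReal
  have h2 : {ω | ∃ n ≤ T, c ≤ ∑ s ∈ Finset.range n, logIncr O g x w s ω} ⊆
      {ω | ENNReal.ofReal (Real.exp c) ≤ F ω} := by
    rintro ω ⟨n, hn, hc⟩
    refine ENNReal.ofReal_le_ofReal (Real.exp_le_exp.2 ?_)
    simp only [hincr]
    exact sum_ite_prefix_ge hn hc
  have h3 := meas_ge_le_lintegral_div (μ := μ) hF.aemeasurable (ε := ENNReal.ofReal (Real.exp c))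
    (by simpa using Real.exp_pos c) ENNReal.ofReal_ne_top
  have h4 : μ {ω | ∃ n ≤ T, c ≤ ∑ s ∈ Finset.range n, logIncr O g x w s ω} ≤
      ENNReal.ofReal (Real.exp (-c)) := by
    refine (measure_mono h2).trans (h3.trans ((ENNReal.div_le_div_right h1 _).trans ?_))
    rw [one_div, ← ENNReal.ofReal_inv_of_pos (Real.exp_pos c), Real.exp_neg]
  exact ENNReal.toReal_le_of_le_ofReal (Real.exp_pos _).le h4

/-- A time-uniform empirical Bernstein inequality. -/
theorem IsSampled.measure_abs_sum_gt_le [CompleteSpace E] (h : IsSampled μ O g x T)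
    {u : ℕ → Ω → E} (hu : ∀ s < T, Measurable[histSigma g s] (u s)) {L δ : ℝ} (hL : 0 < L)
    (hb : ∀ s < T, ∀ ω, ∀ᵐ v ∂(O (x s ω)), |inner ℝ v (u s ω)| ≤ L)
    (hT : 1 ≤ T) (hδ : 0 < δ) (hδ1 : δ < 1) :
    μ.real {ω | ¬ ∀ n ≤ T,
      |∑ s ∈ Finset.range n, (inner ℝ (g s ω) (u s ω) - inner ℝ (∫ v, v ∂(O (x s ω))) (u s ω))| ≤
        4 * (√(theta T δ * ∑ s ∈ Finset.range T, inner ℝ (g s ω) (u s ω) ^ 2)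
          + L * theta T δ)} ≤ δ := by
  set θ := theta T δ with hθdef
  have hθ : 1 ≤ θ := one_le_theta hT hδ hδ1
  set J := Nat.log 2 T + 1 with hJ
  let a : ℕ → ℝ := fun j => 2 * L * 2 ^ j
  have ha : ∀ j, 2 * L ≤ a j := fun j => by
    have : (1 : ℝ) ≤ 2 ^ j := one_le_pow₀ (by norm_num)
    simp only [a]; nlinarith
  have ha0 : ∀ j, 0 < a j := fun j => by positivity
  let B : ℝ → Set Ω := fun l => {ω | ∃ n ≤ T, θ ≤ ∑ s ∈ Finset.range n,
    logIncr O g x (fun s ω => l • u s ω) s ω}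
  have hB : ∀ l : ℝ, |l| * L ≤ 1 / 2 → μ.real (B l) ≤ Real.exp (-θ) := fun l hl => by
    refine h.measure_exists_le (fun s hs => (hu s hs).const_smul l) (fun s hs ω => ?_) θ
    filter_upwards [hb s hs ω] with v hv
    change |inner ℝ v (l • u s ω)| ≤ 1 / 2
    rw [inner_smul_right, abs_mul]
    exact (mul_le_mul_of_nonneg_left hv (abs_nonneg _)).trans hl
  have hBj : ∀ j, μ.real (B (1 / a j) ∪ B (-(1 / a j))) ≤ 2 * Real.exp (-θ) := fun j => by
    have h1 : |1 / a j| * L ≤ 1 / 2 := by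
      rw [abs_of_pos (by have := ha0 j; positivity), div_mul_eq_mul_div, div_le_iff₀ (ha0 j)]
      linarith [ha j]
    have := measureReal_union_le (μ := μ) (B (1 / a j)) (B (-(1 / a j)))
    linarith [hB _ h1, hB (-(1 / a j)) (by rwa [abs_neg])]
  have hunion : μ.real (⋃ j ∈ Finset.range J, (B (1 / a j) ∪ B (-(1 / a j)))) ≤ δ := by
    refine (measureReal_biUnion_finset_le _ _).trans
      ((Finset.sum_le_sum fun j _ => hBj j).trans ?_)
    have h1 := two_mul_natLog_le hT
    have hpos : 0 < 60 * Real.log (6 * T) := by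
      refine lt_of_lt_of_le ?_ h1; positivity
    rw [Finset.sum_const, Finset.card_range, nsmul_eq_mul, hθdef, theta, Real.exp_neg,
      Real.exp_log (by positivity), inv_div]
    rw [← hJ] at h1
    calc (J : ℝ) * (2 * (δ / (60 * Real.log (6 * T))))
        = (2 * (J : ℝ)) * δ / (60 * Real.log (6 * T)) := by ring
      _ ≤ δ := by
        rw [div_le_iff₀ hpos]; nlinarith
  -- The bound on the oracle's law passes to the samples; this caps the empirical variance at L²T,
  -- so the finite grid of scales reaches it.
  have hae : ∀ᵐ ω ∂μ, ∀ s < T, |inner ℝ (g s ω) (u s ω)| ≤ L := by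
    rw [ae_all_iff]
    intro s
    by_cases hs : s < T
    · have := h.ae_mem hs (hu s hs) (S := {p | |inner ℝ p.2 p.1| ≤ L})
        (measurableSet_le (by fun_prop) measurable_const) (hb s hs)
      filter_upwards [this] with ω hω _ using hω
    · exact Filter.Eventually.of_forall fun ω h => absurd h hs
  have hnull : μ.real {ω | ¬ ∀ s < T, |inner ℝ (g s ω) (u s ω)| ≤ L} = 0 := by
    rw [measureReal_def, ae_iff.1 hae, ENNReal.toReal_zero]
  refine (measureReal_mono (s₂ := {ω | ¬ ∀ s < T, |inner ℝ (g s ω) (u s ω)| ≤ L} ∪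
    ⋃ j ∈ Finset.range J, (B (1 / a j) ∪ B (-(1 / a j)))) ?_).trans
    ((measureReal_union_le _ _).trans (by linarith))
  intro ω hω
  by_contra hcon
  simp only [Set.mem_union, Set.mem_iUnion, Set.mem_ofPred_eq, not_or, not_not, not_exists] at hcon
  obtain ⟨hbd, hgrid⟩ := hcon
  refine hω fun n hn => ?_
  set Y : ℕ → ℝ := fun s => inner ℝ (g s ω) (u s ω)
  set m : ℕ → ℝ := fun s => inner ℝ (∫ v, v ∂(O (x s ω))) (u s ω)
  have hV0 : 0 ≤ ∑ s ∈ Finset.range T, Y s ^ 2 := Finset.sum_nonneg fun _ _ => sq_nonneg _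
  have hVT : ∑ s ∈ Finset.range T, Y s ^ 2 ≤ L ^ 2 * T := by
    refine (Finset.sum_le_card_nsmul _ _ (L ^ 2) fun s hs => ?_).trans (le_of_eq ?_)
    · exact sq_le_sq' (abs_le.1 (hbd s (Finset.mem_range.1 hs))).1
        (abs_le.1 (hbd s (Finset.mem_range.1 hs))).2
    · simp [mul_comm]
  obtain ⟨j, hj, hsc⟩ := exists_scale hL hθ hV0 hVT
  refine le_trans ?_ hsc
  have hVn : ∑ s ∈ Finset.range n, Y s ^ 2 ≤ ∑ s ∈ Finset.range T, Y s ^ 2 :=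
    Finset.sum_le_sum_of_subset_of_nonneg (Finset.range_mono hn) fun _ _ _ => sq_nonneg _
  have hsum : ∀ l : ℝ, ∑ s ∈ Finset.range n, logIncr O g x (fun s ω => l • u s ω) s ω =
      l * ∑ s ∈ Finset.range n, (Y s - m s) - l ^ 2 * ∑ s ∈ Finset.range n, Y s ^ 2 := fun l => by
    rw [Finset.mul_sum, Finset.mul_sum, ← Finset.sum_sub_distrib]
    refine Finset.sum_congr rfl fun s _ => ?_
    simp only [logIncr, inner_smul_right, Y, m]
    ring
  have hg := hgrid j (Finset.mem_range.2 hj)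
  have h1 : 1 / a j * ∑ s ∈ Finset.range n, (Y s - m s)
      - (1 / a j) ^ 2 * ∑ s ∈ Finset.range n, Y s ^ 2 < θ := by
    rw [← hsum]; by_contra! hc; exact hg.1 ⟨n, hn, hc⟩
  have h2 : -(1 / a j) * ∑ s ∈ Finset.range n, (Y s - m s)
      - (-(1 / a j)) ^ 2 * ∑ s ∈ Finset.range n, Y s ^ 2 < θ := by
    rw [← hsum]; by_contra! hc; exact hg.2 ⟨n, hn, hc⟩
  change |∑ s ∈ Finset.range n, (Y s - m s)| ≤ (∑ s ∈ Finset.range T, Y s ^ 2) / a j + θ * a j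
  have hap := ha0 j
  set D := ∑ s ∈ Finset.range n, (Y s - m s)
  set Vn := ∑ s ∈ Finset.range n, Y s ^ 2
  have h3 : Vn / a j ≤ (∑ s ∈ Finset.range T, Y s ^ 2) / a j := by gcongr
  have e1 : a j * (1 / a j * D - (1 / a j) ^ 2 * Vn) = D - Vn / a j := by field_simp
  have e2 : a j * (-(1 / a j) * D - (-(1 / a j)) ^ 2 * Vn) = -D - Vn / a j := by field_simp
  have h4 := mul_lt_mul_of_pos_left h1 hap
  have h5 := mul_lt_mul_of_pos_left h2 hap
  rw [e1] at h4
  rw [e2] at h5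
  rw [abs_le]
  constructor <;> linarith

end Sampling

end DoG

namespace DoG

/-! ### Optimality gap along a fixed trajectory. -/

section Deterministic

variable {E : Type*} [NormedAddCommGroup E] [InnerProductSpace ℝ E]
  {X : Set E} {f : E → ℝ} {xs : E} {rε : ℝ} {G' : ℕ → ℝ} {g x : ℕ → E} {T : ℕ}

theorem sub_le_inner_of_mem_subdiff {v y : E} (hv : v ∈ subdiff X f y) (hxs : xs ∈ X) :
    f y - f xs ≤ inner ℝ v (y - xs) := by
  have h := hv xs hxs
  rw [← neg_sub y xs, inner_neg_right] at h
  linarith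

theorem add_rbar_le_mul_logp {E : Type*} [NormedAddCommGroup E] {xs : E} {x : ℕ → E} (hr : 0 < rε) (t : ℕ) :
    ‖x 0 - xs‖ + rbar rε x t ≤ ‖x 0 - xs‖ * logp (rbar rε x t / rε) + rbar rε x t := by
  have := logp_nonneg_of_le hr (le_rbar (x := x) t)
  nlinarith [norm_nonneg (x 0 - xs)]

/-- The direction from the solution to `x t`, scaled into the unit ball. -/
noncomputable def direction (xs : E) (rε : ℝ) (x : ℕ → E) (t : ℕ) : E :=
  (‖x 0 - xs‖ + rbar rε x t)⁻¹ • (x t - xs)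

theorem norm_direction_le_one (hr : 0 < rε) (t : ℕ) : ‖direction xs rε x t‖ ≤ 1 := by
  have h1 : 0 < ‖x 0 - xs‖ + rbar rε x t :=
    add_pos_of_nonneg_of_pos (norm_nonneg _) (hr.trans_le (le_rbar t))
  rw [direction, norm_smul, norm_inv, Real.norm_of_nonneg h1.le, inv_mul_le_iff₀ h1, mul_one]
  exact norm_sub_le_add_rbar le_rfl

variable [FiniteDimensional ℝ E]

theorem mean_gap_le_of_subgradients (hp : ConvexProblem X f xs) (h0 : x 0 ∈ X) (hr : 0 < rε)
    (hT : 1 ≤ T) (h : IsRun X rε G' g x T)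
    (hmono : ∀ s t, s ≤ t → t < T → G' s ≤ G' t) (hle : ∀ t < T, gradSq g t ≤ G' t)
    (hg : ∀ t < T, g t ∈ subdiff X f (x t)) :
    (1 / T : ℝ) * (∑ t ∈ Finset.range T, f (x t)) - f xs ≤
      9 * ((‖x 0 - xs‖ * logp (rbar rε x T / rε) + rbar rε x T) * √(G' (T - 1)) / T) := by
  rw [mean_sub_eq hT, ← mul_div_assoc]
  refine div_le_div_of_nonneg_right ?_ (Nat.cast_nonneg T)
  refine le_trans (Finset.sum_le_sum fun t ht => ?_)
    (h.sum_inner_le hp.isClosed hp.convexOn.1 hp.mem hr h0 hmono hle)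
  exact sub_le_inner_of_mem_subdiff (hg t (Finset.mem_range.1 ht)) hp.mem

theorem mean_gap_le_of_smooth [CompleteSpace E] {S : NNReal} (hX : IsClosed X) (hc : Convex ℝ X)
    (hxs : xs ∈ X) (hf : ConvexOn ℝ Set.univ f) (hmin : ∀ y, f xs ≤ f y)
    (hd : Differentiable ℝ f) (hS : LipschitzWith S (gradient f)) (h0 : x 0 ∈ X) (hr : 0 < rε)
    (hT : 1 ≤ T) (h : IsRun X rε (gradSq g) g x T) (hg : ∀ t < T, g t = gradient f (x t)) :
    (1 / T : ℝ) * (∑ t ∈ Finset.range T, f (x t)) - f xs ≤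
      324 * (S * (‖x 0 - xs‖ * logp (rbar rε x T / rε) + rbar rε x T) ^ 2 / T) := by
  have hp : ConvexProblem X f xs := ⟨hX, hf.subset (Set.subset_univ _) hc, hxs, fun y _ => hmin y⟩
  have hsub : ∀ t < T, g t ∈ subdiff X f (x t) := fun t ht y _ => by
    rw [hg t ht]; exact ConvexOn.add_inner_gradient_le hf hd _ _
  have h1 := mean_gap_le_of_subgradients hp h0 hr hT h
    (fun s t hst _ => gradSq_mono g hst) (fun _ _ => le_rfl) hsub
  have hTpos : (0 : ℝ) < T := by exact_mod_cast hT
  rw [mean_sub_eq hT, ← mul_div_assoc] at h1 ⊢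
  refine div_le_div_of_nonneg_right ?_ hTpos.le
  have h2 := (div_le_div_iff_of_pos_right hTpos).1 h1
  have h3 : gradSq g (T - 1) ≤ 4 * S * ∑ t ∈ Finset.range T, (f (x t) - f xs) := by
    rw [gradSq, Nat.sub_add_cancel hT, Finset.mul_sum]
    refine Finset.sum_le_sum fun t ht => ?_
    rw [hg t (Finset.mem_range.1 ht)]
    exact sq_norm_gradient_le hf hd hS hmin _
  have h4 : 0 ≤ ∑ t ∈ Finset.range T, (f (x t) - f xs) :=
    Finset.sum_nonneg fun t _ => sub_nonneg.2 (hmin _)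
  have h5 := Real.sq_sqrt (gradSq_nonneg g (T - 1))
  set Φ := ∑ t ∈ Finset.range T, (f (x t) - f xs)
  set D := ‖x 0 - xs‖ * logp (rbar rε x T / rε) + rbar rε x T
  have h6 : Φ ^ 2 ≤ (9 * (D * √(gradSq g (T - 1)))) ^ 2 := pow_le_pow_left₀ h4 h2 2
  -- Now Φ² ≤ 81 D² G and G ≤ 4SΦ, hence Φ ≤ 324 S D² after cancelling Φ.
  rw [mul_pow, mul_pow, h5] at h6
  have h7 := mul_le_mul_of_nonneg_left h3 (sq_nonneg D)
  rcases h4.eq_or_lt with h8 | h8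
  · rw [← h8]; positivity
  · refine le_of_mul_le_mul_right ?_ h8
    linarith

/-- The gap is at most regret plus noise. The constant is 9 from the regret and 2·4·2 from the
noise: Abel summation, Bernstein, and two terms each below the final square root. -/
theorem gap_le_of_noise_le (hp : ConvexProblem X f xs) (h0 : x 0 ∈ X) (hr : 0 < rε)
    (hT : 1 ≤ T) (h : IsRun X rε G' g x T) (hG : IsDoGLike G' g T) {p : ℕ → E}
    (hsub : ∀ t < T, p t ∈ subdiff X f (x t)) {L θ : ℝ} (hL : 0 ≤ L) (hθ : 0 ≤ θ)
    (hnoise : ∀ n ≤ T, |∑ s ∈ Finset.range n, (inner ℝ (g s) (direction xs rε x s)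
        - inner ℝ (p s) (direction xs rε x s))| ≤
      4 * (√(θ * ∑ s ∈ Finset.range T, inner ℝ (g s) (direction xs rε x s) ^ 2) + L * θ)) :
    f (avg x T) - f xs ≤ 25 * ((‖x 0 - xs‖ * logp (rbar rε x T / rε) + rbar rε x T) *
      √(G' (T - 1) + gradSq g (T - 1) * θ + L ^ 2 * θ ^ 2) / T) := by
  have hjensen := ConvexOn.map_avg_le hp.convexOn hT fun t ht => h.mem hp.isClosed h0 t ht.le
  suffices hs : ∑ t ∈ Finset.range T, (f (x t) - f xs) ≤
      25 * ((‖x 0 - xs‖ * logp (rbar rε x T / rε) + rbar rε x T) *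
      √(G' (T - 1) + gradSq g (T - 1) * θ + L ^ 2 * θ ^ 2)) by
    refine (sub_le_sub_right hjensen _).trans ?_
    rw [mean_sub_eq hT, ← mul_div_assoc]
    exact div_le_div_of_nonneg_right hs (Nat.cast_nonneg T)
  have hreg := h.sum_inner_le hp.isClosed hp.convexOn.1 hp.mem hr h0 hG.mono hG.le
  have hD := add_rbar_le_mul_logp (x := x) (xs := xs) hr T
  let y : ℕ → ℝ := fun t => ‖x 0 - xs‖ + rbar rε x t
  have hy0 : ∀ t, 0 < y t := fun t =>
    add_pos_of_nonneg_of_pos (norm_nonneg _) (hr.trans_le (le_rbar t))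
  have habel := abs_sum_mul_le (fun t => (hy0 t).le)
    (fun s t hst => add_le_add_right (rbar_mono hst) _ : Monotone y) hnoise
  have hexp : ∀ (v : E) (s : ℕ), y s * inner ℝ v (direction xs rε x s) = inner ℝ v (x s - xs) :=
    fun v s => by rw [direction, inner_smul_right, mul_inv_cancel_left₀ (hy0 s).ne']
  simp only [mul_sub, hexp] at habel
  rw [Finset.sum_sub_distrib] at habel
  have hgap : ∑ t ∈ Finset.range T, (f (x t) - f xs) ≤
      ∑ t ∈ Finset.range T, inner ℝ (p t) (x t - xs) :=
    Finset.sum_le_sum fun t ht =>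
      sub_le_inner_of_mem_subdiff (hsub t (Finset.mem_range.1 ht)) hp.mem
  have hV : ∑ s ∈ Finset.range T, inner ℝ (g s) (direction xs rε x s) ^ 2 ≤ gradSq g (T - 1) := by
    rw [gradSq, Nat.sub_add_cancel hT]
    refine Finset.sum_le_sum fun s _ => ?_
    rw [← sq_abs]
    refine pow_le_pow_left₀ (abs_nonneg _) ((abs_real_inner_le_norm _ _).trans ?_) 2
    exact mul_le_of_le_one_right (norm_nonneg _) (norm_direction_le_one hr s)
  have hGp := (hG.pos (T - 1) (by omega)).le
  have hgs := gradSq_nonneg g (T - 1)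
  set Q := √(G' (T - 1) + gradSq g (T - 1) * θ + L ^ 2 * θ ^ 2)
  have q1 : √(G' (T - 1)) ≤ Q := Real.sqrt_le_sqrt (by nlinarith [mul_nonneg hgs hθ, sq_nonneg (L * θ)])
  have q2 : √(θ * ∑ s ∈ Finset.range T, inner ℝ (g s) (direction xs rε x s) ^ 2) ≤ Q :=
    Real.sqrt_le_sqrt (by nlinarith [mul_le_mul_of_nonneg_left hV hθ, sq_nonneg (L * θ)])
  have q3 : L * θ ≤ Q := Real.le_sqrt_of_sq_le (by nlinarith [mul_nonneg hgs hθ])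
  set D := ‖x 0 - xs‖ * logp (rbar rε x T / rε) + rbar rε x T
  have hyD : y T ≤ D := hD
  have hQ0 : 0 ≤ Q := Real.sqrt_nonneg _
  have hD0 : 0 ≤ D := (hy0 T).le.trans hyD
  have b1 := mul_le_mul_of_nonneg_left q1 hD0
  have b2 : y T * (√(θ * ∑ s ∈ Finset.range T, inner ℝ (g s) (direction xs rε x s) ^ 2) + L * θ)
      ≤ D * (2 * Q) := mul_le_mul hyD (by linarith) (by positivity) hD0
  have b3 := (abs_le.1 habel).1
  linarith

end Deterministic

/-! ### Measurability of the iterates and the high probability bound. -/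

section Stochastic

theorem measurable_rbar {E Ω : Type*} [NormedAddCommGroup E] [MeasurableSpace E] [BorelSpace E]
    [SecondCountableTopology E] {m : MeasurableSpace Ω} {x : ℕ → Ω → E} (rε : ℝ) {t : ℕ}
    (hx : ∀ k ≤ t, Measurable (x k)) : Measurable fun ω => rbar rε (x · ω) t := by
  refine Measurable.max (Finset.measurable_range_sup'' fun k hk => ?_) measurable_const
  exact ((hx k hk).sub (hx 0 t.zero_le)).norm

theorem measurable_direction {E Ω : Type*} [NormedAddCommGroup E] [InnerProductSpace ℝ E]
    [MeasurableSpace E] [BorelSpace E] [SecondCountableTopology E] {m : MeasurableSpace Ω}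
    {x : ℕ → Ω → E} (xs : E) (rε : ℝ) {t : ℕ} (hx : ∀ k ≤ t, Measurable (x k)) :
    Measurable fun ω => direction xs rε (x · ω) t :=
  ((((hx 0 t.zero_le).sub measurable_const).norm.add (measurable_rbar rε hx)).inv).smul
    ((hx t le_rfl).sub measurable_const)

variable {E : Type*} [NormedAddCommGroup E] [InnerProductSpace ℝ E] [FiniteDimensional ℝ E]
  [MeasurableSpace E] [StandardBorelSpace E]
  {Ω : Type*} [MeasurableSpace Ω] {μ : Measure Ω} [IsProbabilityMeasure μ]
  {X : Set E} {f l : E → ℝ} {O : Kernel E E} {xs x₀ : E} {rε : ℝ} {T : ℕ}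
  {G' : ℕ → Ω → ℝ} {g x : ℕ → Ω → E}

theorem IsStochasticRun.mem (h : IsStochasticRun μ X O x₀ rε T G' g x) (hX : IsClosed X)
    (h0 : x₀ ∈ X) {t : ℕ} (ht : t ≤ T) (ω : Ω) : x t ω ∈ X :=
  (h.step ω).mem hX (by simpa [h.start ω] using h0) t ht

variable [BorelSpace E] [SecondCountableTopology E]

theorem IsStochasticRun.measurable_iterate (h : IsStochasticRun μ X O x₀ rε T G' g x)
    (hX : IsClosed X) (hc : Convex ℝ X) (hne : X.Nonempty) :
    ∀ t ≤ T, Measurable[histSigma g t] (x t) := by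
  intro t
  induction t using Nat.strong_induction_on with
  | _ t ih =>
    intro ht
    cases t with
    | zero =>
      rw [show x 0 = fun _ => x₀ from funext h.start]
      exact measurable_const
    | succ t =>
      have hx : ∀ k ≤ t, Measurable[histSigma g (t + 1)] (x k) := fun k hk =>
        (ih k (by omega) (by omega)).mono (histSigma_mono g (by omega)) le_rfl
      obtain ⟨φ, hφ, hG⟩ := h.adapted t ht
      have hG' : Measurable[histSigma g (t + 1)] (G' t) := by
        rw [show G' t = φ ∘ hist g (t + 1) from funext hG]
        exact hφ.comp (measurable_hist g (t + 1))
      have hg := measurable_histSigma_of_lt g t.lt_succ_self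
      rw [show x (t + 1) = fun ω => proj X (x t ω - (rbar rε (x · ω) t / √(G' t ω)) • g t ω) from
        funext fun ω => h.step ω t ht]
      exact (continuous_proj hX hc hne).measurable.comp
        ((hx t le_rfl).sub (((measurable_rbar rε hx).div
          (Real.continuous_sqrt.measurable.comp hG')).smul hg))

theorem IsStochasticRun.isSampled (h : IsStochasticRun μ X O x₀ rε T G' g x)
    (hX : IsClosed X) (hc : Convex ℝ X) (h0 : x₀ ∈ X)
    (hO : IsOracle X f O) : IsSampled μ O g x T where
  measurable_grad := h.measurable_grad
  measurable_query _ ht := h.measurable_iterate hX hc ⟨x₀, h0⟩ _ ht.le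
  integrable _ ht ω := (hO _ (h.mem hX h0 ht.le ω)).1
  law := h.law_grad

/-- The high probability bound for DoG-like schemes. -/
theorem IsStochasticRun.measure_gap_le_ge [IsMarkovKernel O] [CompleteSpace E]
    (h : IsStochasticRun μ X O x₀ rε T G' g x) (hp : ConvexProblem X f xs) (hO : IsOracle X f O)
    (hl : IsBoundedOracle X l O) (h0 : x₀ ∈ X) (hr : 0 < rε) (hT : 1 ≤ T) {δ L : ℝ}
    (hδ : 0 < δ) (hδ1 : δ < 1) (hL : 0 < L) :
    1 - δ - μ.real {ω | L < Lbar l (x · ω) T} ≤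
      μ.real {ω | f (avg (x · ω) T) - f xs ≤
        25 * ((‖x₀ - xs‖ * logp (rbar rε (x · ω) T / rε) + rbar rε (x · ω) T) *
          √(G' (T - 1) ω + gradSq (g · ω) (T - 1) * theta T δ + L ^ 2 * theta T δ ^ 2) / T)} := by
  classical
  have hc := hp.convexOn.1
  have hs := h.isSampled hp.isClosed hc h0 hO
  have hmeas := h.measurable_iterate hp.isClosed hc ⟨x₀, h0⟩
  let K : Set E := X ∩ l ⁻¹' Set.Iic L
  have hK : MeasurableSet K :=
    (hl.1.preimage_isClosed_of_isClosed hp.isClosed isClosed_Iic).measurableSet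
  -- The truncation depends only on x_t, so it is predictable and enforces the bound L everywhere.
  -- It is inactive for t < T unless L̄_T > L.
  let u : ℕ → Ω → E := fun t ω => if x t ω ∈ K then direction xs rε (x · ω) t else 0
  have hu : ∀ t < T, Measurable[histSigma g t] (u t) := fun t ht => by
    have hx : ∀ k ≤ t, Measurable[histSigma g t] (x k) := fun k hk =>
      (hmeas k (by omega)).mono (histSigma_mono g hk) le_rfl
    refine Measurable.ite (hx t le_rfl hK) ?_ measurable_const
    exact measurable_direction xs rε hx
  have hb : ∀ t < T, ∀ ω, ∀ᵐ v ∂(O (x t ω)), |inner ℝ v (u t ω)| ≤ L := fun t ht ω => by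
    filter_upwards [hl.2 _ (h.mem hp.isClosed h0 ht.le ω)] with v hv
    simp only [u]
    split_ifs with hk
    · calc |inner ℝ v (direction xs rε (x · ω) t)|
          ≤ ‖v‖ * ‖direction xs rε (x · ω) t‖ := abs_real_inner_le_norm _ _
        _ ≤ ‖v‖ := mul_le_of_le_one_right (norm_nonneg _) (norm_direction_le_one hr t)
        _ ≤ L := hv.trans hk.2
    · simpa using hL.le
  have hbern := hs.measure_abs_sum_gt_le hu hL hb hT hδ hδ1
  have hdog : μ.real {ω | ¬ IsDoGLike (G' · ω) (g · ω) T} = 0 := by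
    rw [measureReal_def, ae_iff.1 h.dogLike, ENNReal.toReal_zero]
  set bad := {ω | ¬ ∀ n ≤ T, |∑ s ∈ Finset.range n,
    (inner ℝ (g s ω) (u s ω) - inner ℝ (∫ v, v ∂(O (x s ω))) (u s ω))| ≤
      4 * (√(theta T δ * ∑ s ∈ Finset.range T, inner ℝ (g s ω) (u s ω) ^ 2) + L * theta T δ)}
    with hbad
  set good := {ω | f (avg (x · ω) T) - f xs ≤
    25 * ((‖x₀ - xs‖ * logp (rbar rε (x · ω) T / rε) + rbar rε (x · ω) T) *
      √(G' (T - 1) ω + gradSq (g · ω) (T - 1) * theta T δ + L ^ 2 * theta T δ ^ 2) / T)}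
    with hgood
  -- Covering Ω needs only subadditivity, so none of these events has to be shown measurable.
  have hcover : (Set.univ : Set Ω) ⊆
      (good ∪ {ω | L < Lbar l (x · ω) T}) ∪ (bad ∪ {ω | ¬ IsDoGLike (G' · ω) (g · ω) T}) := by
    intro ω _
    by_contra hcon
    simp only [Set.mem_union, not_or] at hcon
    obtain ⟨⟨hg1, hL1⟩, hb1, hd1⟩ := hcon
    rw [Set.mem_ofPred_eq, not_lt] at hL1
    rw [Set.mem_ofPred_eq, not_not] at hd1
    rw [hbad, Set.mem_ofPred_eq, not_not] at hb1
    have hmem : ∀ s < T, u s ω = direction xs rε (x · ω) s := fun s hs => by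
      have h1 : l (x s ω) ≤ Lbar l (x · ω) T :=
        Finset.le_sup' (fun k => l (x k ω)) (Finset.mem_range.2 (by omega))
      exact if_pos ⟨h.mem hp.isClosed h0 hs.le ω, h1.trans hL1⟩
    refine hg1 ?_
    have hx0 := h.start ω
    rw [hgood, Set.mem_ofPred_eq, ← hx0]
    refine gap_le_of_noise_le (x := (x · ω)) (g := (g · ω)) (G' := (G' · ω))
      (p := fun s => ∫ v, v ∂(O (x s ω))) hp (by rw [hx0]; exact h0) hr hT (h.step ω) hd1
      (fun t ht => (hO _ (h.mem hp.isClosed h0 ht.le ω)).2) hL.le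
      (zero_le_one.trans (one_le_theta hT hδ hδ1)) fun n hn => ?_
    have e1 : ∑ s ∈ Finset.range n, (inner ℝ (g s ω) (direction xs rε (x · ω) s)
        - inner ℝ (∫ v, v ∂(O (x s ω))) (direction xs rε (x · ω) s)) =
        ∑ s ∈ Finset.range n,
          (inner ℝ (g s ω) (u s ω) - inner ℝ (∫ v, v ∂(O (x s ω))) (u s ω)) :=
      Finset.sum_congr rfl fun s hs => by
        rw [hmem s ((Finset.mem_range.1 hs).trans_le hn)]
    have e2 : ∑ s ∈ Finset.range T, inner ℝ (g s ω) (direction xs rε (x · ω) s) ^ 2 =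
        ∑ s ∈ Finset.range T, inner ℝ (g s ω) (u s ω) ^ 2 :=
      Finset.sum_congr rfl fun s hs => by rw [hmem s (Finset.mem_range.1 hs)]
    rw [e1, e2]
    exact hb1 n hn
  have h1 := measureReal_mono (μ := μ) hcover
  rw [probReal_univ] at h1
  have h2 := measureReal_union_le (μ := μ) (good ∪ {ω | L < Lbar l (x · ω) T})
    (bad ∪ {ω | ¬ IsDoGLike (G' · ω) (g · ω) T})
  have h3 := measureReal_union_le (μ := μ) good {ω | L < Lbar l (x · ω) T}
  have h4 := measureReal_union_le (μ := μ) bad {ω | ¬ IsDoGLike (G' · ω) (g · ω) T}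
  linarith

end Stochastic

end DoG

theorem mainTheorem5 :
    ∃ C : ℝ, 0 < C ∧
    -- the high probability bound for stochastic gradients
    (∀ (m : ℕ) (X : Set (EuclideanSpace ℝ (Fin m))) (f l : EuclideanSpace ℝ (Fin m) → ℝ)
      (xs x₀ : EuclideanSpace ℝ (Fin m))
      (O : Kernel (EuclideanSpace ℝ (Fin m)) (EuclideanSpace ℝ (Fin m))) [IsMarkovKernel O]
      (Ω : Type*) [MeasurableSpace Ω] (μ : Measure Ω) [IsProbabilityMeasure μ]
      (G' : ℕ → Ω → ℝ) (g x : ℕ → Ω → EuclideanSpace ℝ (Fin m)) (T : ℕ) (rε δ L : ℝ),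
      DoG.ConvexProblem X f xs → DoG.IsOracle X f O → DoG.IsBoundedOracle X l O →
      x₀ ∈ X → 0 < rε → 1 ≤ T → 0 < δ → δ < 1 → 0 < L →
      DoG.IsStochasticRun μ X O x₀ rε T G' g x →
      1 - δ - μ.real {ω | L < DoG.Lbar l (x · ω) T} ≤
        μ.real {ω | f (DoG.avg (x · ω) T) - f xs ≤
          C * ((‖x₀ - xs‖ * DoG.logp (DoG.rbar rε (x · ω) T / rε) + DoG.rbar rε (x · ω) T) *
            √(G' (T - 1) ω + DoG.gradSq (g · ω) (T - 1) * DoG.theta T δ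
              + L ^ 2 * DoG.theta T δ ^ 2) / T)}) ∧
    -- the noiseless case
    (∀ (m : ℕ) (X : Set (EuclideanSpace ℝ (Fin m))) (f : EuclideanSpace ℝ (Fin m) → ℝ)
      (xs : EuclideanSpace ℝ (Fin m)) (G' : ℕ → ℝ) (g x : ℕ → EuclideanSpace ℝ (Fin m))
      (T : ℕ) (rε : ℝ),
      DoG.ConvexProblem X f xs → x 0 ∈ X → 0 < rε → 1 ≤ T →
      DoG.IsRun X rε G' g x T → DoG.IsDoGLike G' g T →
      (∀ t < T, g t ∈ DoG.subdiff X f (x t)) →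
      f (DoG.avg x T) - f xs ≤ (1 / T : ℝ) * (∑ t ∈ Finset.range T, f (x t)) - f xs ∧
      (1 / T : ℝ) * (∑ t ∈ Finset.range T, f (x t)) - f xs ≤
        C * ((‖x 0 - xs‖ * DoG.logp (DoG.rbar rε x T / rε) + DoG.rbar rε x T) *
          √(G' (T - 1)) / T)) ∧
    -- the smooth noiseless case, for the scheme with `G' = G`
    (∀ (m : ℕ) (X : Set (EuclideanSpace ℝ (Fin m))) (f : EuclideanSpace ℝ (Fin m) → ℝ)
      (xs : EuclideanSpace ℝ (Fin m)) (S : NNReal) (g x : ℕ → EuclideanSpace ℝ (Fin m))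
      (T : ℕ) (rε : ℝ),
      IsClosed X → Convex ℝ X → xs ∈ X → ConvexOn ℝ Set.univ f → (∀ y, f xs ≤ f y) →
      Differentiable ℝ f → LipschitzWith S (gradient f) →
      x 0 ∈ X → 0 < rε → 1 ≤ T →
      DoG.IsRun X rε (DoG.gradSq g) g x T →
      (∀ t < T, g t = gradient f (x t)) →
      f (DoG.avg x T) - f xs ≤ (1 / T : ℝ) * (∑ t ∈ Finset.range T, f (x t)) - f xs ∧
      (1 / T : ℝ) * (∑ t ∈ Finset.range T, f (x t)) - f xs ≤
        C * (S * (‖x 0 - xs‖ * DoG.logp (DoG.rbar rε x T / rε) + DoG.rbar rε x T) ^ 2 / T)) := by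
  -- Any constant above 25, 9 and 324 serves.
  refine ⟨400, by norm_num, ?_, ?_, ?_⟩
  · intro m X f l xs x₀ O _ Ω _ μ _ G' g x T rε δ L hp hO hl h0 hr hT hδ hδ1 hL h
    refine (h.measure_gap_le_ge hp hO hl h0 hr hT hδ hδ1 hL).trans (measureReal_mono ?_)
    intro ω hω
    rw [Set.mem_ofPred_eq] at hω ⊢
    refine hω.trans (mul_le_mul_of_nonneg_right (by norm_num) ?_)
    have hD := DoG.add_rbar_le_mul_logp (x := (x · ω)) (xs := xs) hr T
    rw [h.start ω] at hD
    have h1 : 0 < DoG.rbar rε (x · ω) T := hr.trans_le (DoG.le_rbar T)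
    have h2 := hD.trans' (add_nonneg (norm_nonneg (x₀ - xs)) h1.le)
    positivity
  · intro m X f xs G' g x T rε hp h0 hr hT h hG hg
    refine ⟨sub_le_sub_right (DoG.ConvexOn.map_avg_le hp.convexOn hT
      fun t ht => h.mem hp.isClosed h0 t ht.le) _, ?_⟩
    refine (DoG.mean_gap_le_of_subgradients hp h0 hr hT h hG.mono hG.le hg).trans
      (mul_le_mul_of_nonneg_right (by norm_num) ?_)
    have h1 : 0 < DoG.rbar rε x T := hr.trans_le (DoG.le_rbar T)
    have h2 := (DoG.add_rbar_le_mul_logp (x := x) (xs := xs) hr T).trans'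
      (add_nonneg (norm_nonneg _) h1.le)
    positivity
  · intro m X f xs S g x T rε hX hc hxs hf hmin hd hS h0 hr hT h hg
    refine ⟨sub_le_sub_right (DoG.ConvexOn.map_avg_le (hf.subset (Set.subset_univ _) hc) hT
      fun t ht => h.mem hX h0 t ht.le) _, ?_⟩
    refine (DoG.mean_gap_le_of_smooth hX hc hxs hf hmin hd hS h0 hr hT h hg).trans
      (mul_le_mul_of_nonneg_right (by norm_num) (by positivity))
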